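/- Conventions. An evolution algebra is an algebra over $\mathbb{C}$ (bilinear product, not necessarily associative or unital) that has a natural basis, i.e. a linear basis in which the product of any two distinct elements is $0$. It is complete if every subalgebra has a natural basis that extends to a natural basis of the whole algebra. Put $\mathcal{E}^1=\mathcal{E}$ and $\mathcal{E}^k=\sum_{i=1}^{k-1}\mathcal{E}^i\mathcal{E}^{k-i}$ for $k\ge 2$; $\mathcal{E}$ is nilpotent if $\mathcal{E}^k=0$ for some $k\ge 1$, and the least such $k$ is its index of nilpotency. An $s$-dimensional nilpotent evolution algebra has maximal index of nilpotency if its index is the largest one among all $s$-dimensional nilpotent evolution algebras. Let $\mathbb{C}^k$ denote the $k$-dimensional algebra with zero product and $\{e_1^2=e_1\}$ the one-dimensional algebra with basis $e_1$ and product $e_1^2=e_1$. Theorem. Let $n\ge 0$, and let $\mathcal{E}$ be an $n$-dimensional complete evolution algebra over $\mathbb{C}$ that is not nilpotent. Then $\mathcal{E}$ is isomorphic to $$\{e_1^2=e_1\}\oplus\mathbb{C}^{n-1}\qquad\text{or to}\qquad \{e_1^2=e_1\}\oplus\widetilde{\mathcal{E}}\oplus\mathbb{C}^{n-s-1}$$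 for some $s$ with $2\le s\le n-1$ and some $s$-dimensional nilpotent evolution algebra $\widetilde{\mathcal{E}}$ of maximal index of nilpotency. These algebras are pairwise non-isomorphic in the following sense: the first one is not isomorphic to any algebra of the second form with $2\le s\le n-1$; and if $2\le s,t\le n-1$ and $\widetilde{\mathcal{E}}$, $\widetilde{\mathcal{F}}$ are evolution algebras of maximal index of nilpotency, of dimensions $s$ and $t$, such that $$\{e_1^2=e_1\}\oplus\widetilde{\mathcal{E}}\oplus\mathbb{C}^{n-s-1}\;\cong\;\{e_1^2=e_1\}\oplus\widetilde{\mathcal{F}}\oplus\mathbb{C}^{n-t-1},$$ then $s=t$ and $\widetilde{\mathcal{E}}\cong\widetilde{\mathcal{F}}$. -/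

import Mathlib

namespace EvolutionAlgebra

/-- `B` is a natural basis of the subspace `S` of the algebra `A`: a linear basis of `S`, any two
distinct elements of which have product zero. -/
structure IsNaturalBasisOf (K : Type*) {A : Type*} [Field K] [NonUnitalNonAssocRing A] [Module K A]
    (S : Submodule K A) (B : Set A) : Prop where
  linearIndepOn : LinearIndepOn K id B
  span_eq : Submodule.span K B = S
  mul_eq_zero : ∀ x ∈ B, ∀ y ∈ B, x ≠ y → x * y = 0

/-- An evolution algebra is an algebra that has a natural basis. -/
def IsEvolutionAlgebra (K A : Type*) [Field K] [NonUnitalNonAssocRing A] [Module K A] : Prop :=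
  ∃ B : Set A, IsNaturalBasisOf K (⊤ : Submodule K A) B

/-- An evolution algebra is complete if every subalgebra has a natural basis that extends to
a natural basis of the whole algebra. -/
def IsCompleteEvolutionAlgebra (K A : Type*) [Field K] [NonUnitalNonAssocRing A] [Module K A] :
    Prop :=
  IsEvolutionAlgebra K A ∧
    ∀ S : NonUnitalSubalgebra K A, ∃ B B' : Set A,
      IsNaturalBasisOf K S.toSubmodule B ∧ B ⊆ B' ∧ IsNaturalBasisOf K (⊤ : Submodule K A) B'

/-- The powers `A¹ = A`, `Aᵏ = ∑_{1 ≤ i < k} Aⁱ Aᵏ⁻ⁱ` of a not necessarily associative algebra,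
where `P Q` denotes the linear span of the products `x * y`, `x ∈ P`, `y ∈ Q`. The value at `0`
is a convention and is not used. -/
def power (K A : Type*) [Field K] [NonUnitalNonAssocRing A] [Module K A] : ℕ → Submodule K A
  | 0 => ⊤
  | 1 => ⊤
  | k + 2 => ⨆ i : Fin (k + 1), Submodule.span K
      (Set.image2 (fun x y : A => x * y) (power K A (i.val + 1)) (power K A (k + 1 - i.val)))
  termination_by k => k
  decreasing_by all_goals omega

/-- `A` is nilpotent if `Aᵏ = 0` for some `k ≥ 1`. -/
def IsNilpotentAlgebra (K A : Type*) [Field K] [NonUnitalNonAssocRing A] [Module K A] : Prop :=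
  ∃ k : ℕ, 1 ≤ k ∧ power K A k = ⊥

/-- The index of nilpotency of a nilpotent algebra: the least `k ≥ 1` such that `Aᵏ = 0`. -/
noncomputable def nilpotencyIndex (K A : Type*) [Field K] [NonUnitalNonAssocRing A] [Module K A] :
    ℕ :=
  sInf {k : ℕ | 1 ≤ k ∧ power K A k = ⊥}

/-- `A` is an `s`-dimensional nilpotent evolution algebra whose index of nilpotency is the largest
one among all `s`-dimensional nilpotent evolution algebras. -/
structure HasMaximalNilpotencyIndex.{u, v} (K : Type u) (A : Type v) [Field K]
    [NonUnitalNonAssocRing A] [Module K A] (s : ℕ) : Prop where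
  finiteDimensional : FiniteDimensional K A
  finrank_eq : Module.finrank K A = s
  isEvolutionAlgebra : IsEvolutionAlgebra K A
  isNilpotentAlgebra : IsNilpotentAlgebra K A
  maximal : ∀ (B : Type v) [NonUnitalNonAssocRing B] [Module K B] [SMulCommClass K B B]
    [IsScalarTower K B B] [FiniteDimensional K B], Module.finrank K B = s →
    IsEvolutionAlgebra K B → IsNilpotentAlgebra K B → nilpotencyIndex K B ≤ nilpotencyIndex K A

/-- Isomorphism of not necessarily associative or unital algebras. -/
def Isomorphic (K A B : Type*) [Field K] [NonUnitalNonAssocRing A] [Module K A]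
    [NonUnitalNonAssocRing B] [Module K B] : Prop :=
  ∃ f : A →ₙₐ[K] B, Function.Bijective f

/-- The zero algebra of dimension `k`: the vector space `Kᵏ` in which all products are zero. -/
def ZeroAlgebra (K : Type*) (k : ℕ) : Type _ := Fin k → K

instance (K : Type*) [Field K] (k : ℕ) : AddCommGroup (ZeroAlgebra K k) :=
  inferInstanceAs (AddCommGroup (Fin k → K))

instance (K : Type*) [Field K] (k : ℕ) : Module K (ZeroAlgebra K k) :=
  inferInstanceAs (Module K (Fin k → K))

instance (K : Type*) [Field K] (k : ℕ) : NonUnitalNonAssocRing (ZeroAlgebra K k) :=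
  { (inferInstance : AddCommGroup (ZeroAlgebra K k)) with
    mul := fun _ _ => 0
    left_distrib := fun _ _ _ => (add_zero (0 : ZeroAlgebra K k)).symm
    right_distrib := fun _ _ _ => (add_zero (0 : ZeroAlgebra K k)).symm
    zero_mul := fun _ => rfl
    mul_zero := fun _ => rfl }

end EvolutionAlgebra

set_option linter.unusedSectionVars false

/-! Completeness is used mostly through `HasAdaptedBases`: every subalgebra has a natural basis
whose elements satisfy `b A ⊆ K b²`. It follows that every subalgebra is an ideal, that `x² ∈ I`
forces `x A ⊆ I` for an ideal `I`, and that there is at most one nonzero idempotent.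

Let `I` be the stable term of the upper annihilator series of a non-nilpotent `A`; it is proper.
Modulo `I` no nonzero element has square zero, so the squares of a natural basis form an invertible
matrix, and a system of quadrics with a nonzero solution (`exists_sq_eq_vecMul`) yields a nonzero
idempotent modulo `I`, which lifts to an idempotent `e` of `A`. If `I + K e` were proper, the same
argument modulo `I + K e` would give a second idempotent. Hence `A = K e ⊕ I` with `I` nilpotent.

A nilpotent `N` with adapted bases and nonzero product splits as `F ⊕ Z`, where `F = K x₀ + N²` and
`Z` lies in the annihilator (`exists_generator`). Squaring descends at most one level of the
annihilator series, and in `F` that series grows by at most one dimension per step, so `F^(2^(s-1))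
≠ 0` for `s = dim F`. Every `s`-dimensional nilpotent evolution algebra has index at most `2^(s-1) +
1`, so `F` is maximal; `ShiftAlgebra` shows that this bound is attained.

For uniqueness, the annihilator of a maximal `F` is a line inside `F²`. An embedding of `F` into `ℂ
× G × ℂᵏ` can be nonzero on that line only in the `G` component, and a homomorphism from a nilpotent
algebra that is injective on the annihilator is injective. Embeddings in both directions finish the
proof. -/

namespace EvolutionAlgebra

/-! ### Nonzero solutions of a system of quadrics. -/

section Quadrics

open MvPolynomial

variable {K σ : Type*} [Field K]

/-- The polynomials of total degree less than `d`. -/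
noncomputable def degLT (K σ : Type*) [Field K] (d : ℕ) : Submodule K (MvPolynomial σ K) :=
  restrictSupport K {n : σ →₀ ℕ | n.degree < d}

theorem mem_degLT {d : ℕ} {p : MvPolynomial σ K} :
    p ∈ degLT K σ d ↔ ∀ n ∈ p.support, n.degree < d := by
  rw [degLT, mem_restrictSupport_iff]
  exact Iff.rfl

theorem degLT_mono {d e : ℕ} (h : d ≤ e) : degLT K σ d ≤ degLT K σ e := by
  intro p hp
  rw [mem_degLT] at hp ⊢
  exact fun n hn => (hp n hn).trans_le h

theorem mul_mem_degLT {d e : ℕ} {p q : MvPolynomial σ K} (hp : p ∈ degLT K σ (d + 1))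
    (hq : q ∈ degLT K σ e) : p * q ∈ degLT K σ (d + e) := by
  classical
  rw [mem_degLT] at *
  intro n hn
  obtain ⟨a, ha, b, hb, rfl⟩ := Finset.mem_add.1 (support_mul p q hn)
  have h1 := hp a ha
  have h2 := hq b hb
  rw [map_add]
  omega

theorem exists_mem_degLT (p : MvPolynomial σ K) : ∃ d, p ∈ degLT K σ d := by
  refine ⟨p.support.sup Finsupp.degree + 1, mem_degLT.2 fun n hn => ?_⟩
  have := Finset.le_sup (f := Finsupp.degree) hn
  omega

theorem eq_zero_of_mem_degLT_zero {p : MvPolynomial σ K} (hp : p ∈ degLT K σ 0) : p = 0 := by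
  rw [mem_degLT] at hp
  rw [← support_eq_empty]
  exact Finset.eq_empty_of_forall_notMem fun n hn => absurd (hp n hn) (Nat.not_lt_zero _)

/-- `q` has degree at most `d` and `p` agrees with it up to terms of degree less than `d`. -/
def SameLeading (d : ℕ) (p q : MvPolynomial σ K) : Prop :=
  q ∈ degLT K σ (d + 1) ∧ p - q ∈ degLT K σ d

theorem SameLeading.mul {d e : ℕ} {p q p' q' : MvPolynomial σ K} (h : SameLeading d p q)
    (h' : SameLeading e p' q') : SameLeading (d + e) (p * p') (q * q') := by
  refine ⟨(mul_mem_degLT h.1 h'.1 : q * q' ∈ degLT K σ (d + (e + 1))), ?_⟩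
  have hp' : p' ∈ degLT K σ (e + 1) := by
    have := add_mem (degLT_mono (Nat.le_succ e) h'.2) h'.1
    rwa [sub_add_cancel] at this
  have h1 : p' * (p - q) ∈ degLT K σ (e + d) := mul_mem_degLT hp' h.2
  have h2 : q * (p' - q') ∈ degLT K σ (d + e) := mul_mem_degLT h.1 h'.2
  rw [add_comm] at h1
  have := add_mem h1 h2
  convert this using 1
  ring

theorem SameLeading.one : SameLeading 0 (1 : MvPolynomial σ K) 1 := by
  refine ⟨mem_degLT.2 fun n hn => ?_, by simp⟩
  classical
  rw [support_one, Finset.mem_singleton] at hn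
  simp [hn]

theorem SameLeading.pow {d : ℕ} {p q : MvPolynomial σ K} (h : SameLeading d p q) (k : ℕ) :
    SameLeading (k * d) (p ^ k) (q ^ k) := by
  induction k with
  | zero => simpa using SameLeading.one
  | succ k ih => simpa only [pow_succ, Nat.succ_mul] using ih.mul h

theorem SameLeading.prod {ι : Type*} (s : Finset ι) {d : ι → ℕ} {p q : ι → MvPolynomial σ K}
    (h : ∀ i, SameLeading (d i) (p i) (q i)) :
    SameLeading (∑ i ∈ s, d i) (∏ i ∈ s, p i) (∏ i ∈ s, q i) := by
  classical
  induction s using Finset.induction_on with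
  | empty => simpa using SameLeading.one
  | insert i s hi ih =>
    rw [Finset.sum_insert hi, Finset.prod_insert hi, Finset.prod_insert hi]
    exact (h i).mul ih

theorem X_mem_degLT (j : σ) : (X j : MvPolynomial σ K) ∈ degLT K σ 2 := by
  classical
  refine mem_degLT.2 fun n hn => ?_
  rw [support_X, Finset.mem_singleton] at hn
  simp [hn]

theorem X_notMem_span_sq (i : σ) :
    (X i : MvPolynomial σ K) ∉ Ideal.span (Set.range fun j : σ => (X j : MvPolynomial σ K) ^ 2) := by
  classical
  intro h
  have hS : (Set.range fun j : σ => (X j : MvPolynomial σ K) ^ 2) =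
      (fun n => monomial n (1 : K)) '' Set.range fun j : σ => Finsupp.single j 2 := by
    rw [← Set.range_comp]
    exact congrArg Set.range (funext fun j => X_pow_eq_monomial)
  rw [hS, mem_ideal_span_monomial_image] at h
  obtain ⟨_, ⟨j, rfl⟩, hj⟩ := h (Finsupp.single i 1) (by simp [support_X])
  have := Finsupp.degree_mono hj
  simp at this

variable [Fintype σ]

/-- The quadric `X_j² - ∑_k N_{kj} X_k`. -/
noncomputable def quadric (N : Matrix σ σ K) (j : σ) : MvPolynomial σ K :=
  X j ^ 2 - ∑ k, C (N k j) * X k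

theorem sameLeading_quadric (N : Matrix σ σ K) (j : σ) :
    SameLeading 2 (quadric N j) (X j ^ 2) := by
  constructor
  · rw [pow_two]
    exact (mul_mem_degLT (d := 1) (e := 2) (X_mem_degLT j) (X_mem_degLT j) :
      (X j * X j : MvPolynomial σ K) ∈ degLT K σ 3)
  · rw [quadric, sub_sub_cancel_left]
    refine neg_mem (sum_mem fun k _ => ?_)
    rw [← smul_eq_C_mul]
    exact Submodule.smul_mem _ _ (X_mem_degLT k)

/-- The linear endomorphism of the polynomial ring that replaces every `X_j²` by the quadric
`X_j² - ∑_k N_{kj} X_k` in every monomial. -/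
noncomputable def replaceSquares (N : Matrix σ σ K) : MvPolynomial σ K →ₗ[K] MvPolynomial σ K :=
  (basisMonomials σ K).constr K
    (fun a => ∏ j, (quadric N j ^ (a j / 2) * X j ^ (a j % 2)))

theorem replaceSquares_monomial (N : Matrix σ σ K) (a : σ →₀ ℕ) :
    replaceSquares N (monomial a 1) = ∏ j, (quadric N j ^ (a j / 2) * X j ^ (a j % 2)) := by
  have := (basisMonomials σ K).constr_basis K
    (fun a => ∏ j, (quadric N j ^ (a j / 2) * X j ^ (a j % 2))) a
  rwa [coe_basisMonomials] at this

theorem sameLeading_replaceSquares (N : Matrix σ σ K) (a : σ →₀ ℕ) :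
    SameLeading a.degree (replaceSquares N (monomial a 1)) (monomial a 1) := by
  have hX : ∀ j : σ, SameLeading 1 (X j : MvPolynomial σ K) (X j) := fun j =>
    ⟨X_mem_degLT j, by simp⟩
  have h := SameLeading.prod (Finset.univ : Finset σ) fun j =>
    ((sameLeading_quadric N j).pow (a j / 2)).mul ((hX j).pow (a j % 2))
  rw [replaceSquares_monomial]
  convert h using 1
  · rw [Finsupp.degree_eq_sum]
    exact Finset.sum_congr rfl fun j _ => by omega
  · rw [monomial_eq, C_1, one_mul, Finsupp.prod_fintype _ _ (fun _ => pow_zero _)]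
    refine Finset.prod_congr rfl fun j _ => ?_
    rw [← pow_mul, ← pow_add, Nat.div_add_mod]

theorem replaceSquares_sub_mem (N : Matrix σ σ K) {d : ℕ} {p : MvPolynomial σ K}
    (hp : p ∈ degLT K σ (d + 1)) : replaceSquares N p - p ∈ degLT K σ d := by
  rw [mem_degLT] at hp
  have h : replaceSquares N p - p =
      ∑ a ∈ p.support, coeff a p • (replaceSquares N (monomial a 1) - monomial a 1) := by
    conv_lhs => rw [p.as_sum]
    rw [map_sum, ← Finset.sum_sub_distrib]
    refine Finset.sum_congr rfl fun a _ => ?_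
    rw [smul_sub, ← map_smul, smul_monomial, smul_eq_mul, mul_one]
  rw [h]
  refine sum_mem fun a ha => Submodule.smul_mem _ _ ?_
  exact degLT_mono (Nat.lt_succ_iff.1 (hp a ha)) (sameLeading_replaceSquares N a).2

/-- The map is unitriangular for the degree filtration: it differs from the identity by terms of
lower degree. Induction on the degree gives this and the surjectivity. -/
theorem replaceSquares_injective (N : Matrix σ σ K) : Function.Injective (replaceSquares N) := by
  rw [← LinearMap.ker_eq_bot, LinearMap.ker_eq_bot']
  intro p hp
  obtain ⟨d, hd⟩ := exists_mem_degLT p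
  induction d with
  | zero => exact eq_zero_of_mem_degLT_zero hd
  | succ d ih =>
    refine ih ?_
    have := replaceSquares_sub_mem N hd
    rwa [hp, zero_sub, neg_mem_iff] at this

theorem replaceSquares_surjective (N : Matrix σ σ K) : Function.Surjective (replaceSquares N) := by
  intro p
  obtain ⟨d, hd⟩ := exists_mem_degLT p
  induction d generalizing p with
  | zero => exact ⟨0, by rw [map_zero, eq_zero_of_mem_degLT_zero hd]⟩
  | succ d ih =>
    obtain ⟨q, hq⟩ := ih _ (replaceSquares_sub_mem N hd)
    exact ⟨p - q, by rw [map_sub, hq]; abel⟩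

/-- This carries the ideal of the `X_j²` onto the ideal of the quadrics, so membership questions
reduce to a monomial ideal. -/
theorem replaceSquares_sq_mul (N : Matrix σ σ K) (i : σ) (p : MvPolynomial σ K) :
    replaceSquares N (X i ^ 2 * p) = quadric N i * replaceSquares N p := by
  classical
  suffices h : replaceSquares N ∘ₗ LinearMap.mulLeft K (X i ^ 2) =
      LinearMap.mulLeft K (quadric N i) ∘ₗ replaceSquares N from LinearMap.congr_fun h p
  refine (basisMonomials σ K).ext fun a => ?_
  simp only [coe_basisMonomials, LinearMap.comp_apply, LinearMap.mulLeft_apply]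
  rw [X_pow_eq_monomial, monomial_mul, one_mul, replaceSquares_monomial, replaceSquares_monomial,
    ← Finset.mul_prod_erase Finset.univ _ (Finset.mem_univ i),
    ← Finset.mul_prod_erase Finset.univ
      (fun j => quadric N j ^ (a j / 2) * X j ^ (a j % 2)) (Finset.mem_univ i), ← mul_assoc]
  congr 1
  · have h1 : ((Finsupp.single i 2 + a : σ →₀ ℕ) i) / 2 = a i / 2 + 1 := by simp
    have h2 : ((Finsupp.single i 2 + a : σ →₀ ℕ) i) % 2 = a i % 2 := by simp
    rw [h1, h2, pow_succ]
    ring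
  · refine Finset.prod_congr rfl fun j hj => ?_
    have : (Finsupp.single i 2 + a : σ →₀ ℕ) j = a j := by
      rw [Finsupp.add_apply, Finsupp.single_eq_of_ne (Finset.ne_of_mem_erase hj), zero_add]
    rw [this]

/-- None of the variables lies in the ideal generated by the quadrics. -/
theorem X_notMem_span_quadric (N : Matrix σ σ K) (i : σ) :
    X i ∉ Ideal.span (Set.range (quadric N)) := by
  intro h
  obtain ⟨g, hg⟩ := (Ideal.mem_span_range_iff_exists_fun).1 h
  choose g' hg' using fun j => replaceSquares_surjective N (g j)
  -- `X_i` contains no square of a variable, so nothing is replaced.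
  have hX : replaceSquares N (X i) = X i := by
    have h := replaceSquares_monomial N (Finsupp.single i 1)
    classical
    rw [← Finset.mul_prod_erase Finset.univ _ (Finset.mem_univ i), Finset.prod_eq_one] at h
    · simp only [Finsupp.single_eq_same, Nat.reduceDiv, pow_zero, Nat.one_mod, pow_one, one_mul,
        mul_one] at h
      exact h
    · intro j hj
      simp [Finsupp.single_eq_of_ne (Finset.ne_of_mem_erase hj)]
  refine X_notMem_span_sq (K := K) i (Ideal.mem_span_range_iff_exists_fun.2 ⟨g', ?_⟩)
  refine replaceSquares_injective N ?_
  rw [hX, map_sum, ← hg]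
  refine Finset.sum_congr rfl fun j _ => ?_
  rw [mul_comm, replaceSquares_sq_mul, hg', mul_comm]

/-- In the spirit of Bézout: the origin is a simple zero of the quadrics, so it cannot be the only
one. If it were, the Nullstellensatz and a Nakayama argument would put every variable in the ideal
of the quadrics. -/
theorem exists_sq_eq_vecMul [IsAlgClosed K] [DecidableEq σ] [Nonempty σ] (N M : Matrix σ σ K)
    (hNM : N * M = 1) :
    ∃ x : σ → K, x ≠ 0 ∧ ∀ j, x j ^ 2 = Matrix.vecMul x N j := by
  by_contra hcon
  push Not at hcon
  set I : Ideal (MvPolynomial σ K) := Ideal.span (Set.range (quadric N)) with hI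
  set m : Ideal (MvPolynomial σ K) := Ideal.span (Set.range X) with hm
  have hrad : m ≤ I.radical := by
    rw [← vanishingIdeal_zeroLocus_eq_radical (K := K), hm, Ideal.span_le]
    rintro _ ⟨i, rfl⟩
    intro x hx
    have hx0 : x = 0 := by
      by_contra hne
      obtain ⟨j, hj⟩ := hcon x hne
      apply hj
      have := hx _ (Ideal.subset_span (Set.mem_range_self j))
      simp only [quadric, map_sub, map_pow, aeval_X, map_sum, map_mul, algHom_C,
        Algebra.algebraMap_self, RingHom.id_apply, sub_eq_zero] at this
      rw [this, Matrix.vecMul, dotProduct]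
      exact Finset.sum_congr rfl fun k _ => mul_comm _ _
    simp [hx0]
  obtain ⟨n, hn⟩ := Ideal.exists_pow_le_of_le_radical_of_fg hrad
    (Submodule.fg_span (Set.finite_range _))
  -- Since `N` is invertible, each variable is a combination of the linear parts of the quadrics.
  have hsq : m ≤ I ⊔ m ^ 2 := by
    rw [hm, Ideal.span_le]
    rintro _ ⟨i, rfl⟩
    have hXi : (X i : MvPolynomial σ K) = ∑ j, C (M j i) * (X j ^ 2 - quadric N j) := by
      have : ∀ j, (X j ^ 2 - quadric N j : MvPolynomial σ K) = ∑ k, C (N k j) * X k := by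
        intro j; rw [quadric]; ring
      simp only [this, Finset.mul_sum]
      rw [Finset.sum_comm]
      have h2 : ∀ k, ∑ j, C (M j i) * (C (N k j) * (X k : MvPolynomial σ K)) =
          C ((N * M) k i) * X k := by
        intro k
        rw [Matrix.mul_apply, map_sum, Finset.sum_mul]
        refine Finset.sum_congr rfl fun j _ => ?_
        rw [map_mul]; ring
      simp only [h2, hNM, Matrix.one_apply]
      rw [Finset.sum_eq_single i]
      · simp
      · intro k _ hk; simp [hk]
      · simp
    rw [SetLike.mem_coe, hXi]
    refine sum_mem fun j _ => Ideal.mul_mem_left _ _ (sub_mem ?_ ?_)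
    · exact Ideal.mem_sup_right (Ideal.pow_mem_pow (Ideal.subset_span (Set.mem_range_self j)) 2)
    · exact Ideal.mem_sup_left (Ideal.subset_span (Set.mem_range_self j))
  have hpow : ∀ k, m ≤ I ⊔ m ^ (k + 1) := by
    intro k
    induction k with
    | zero => simp
    | succ k ih =>
      refine hsq.trans (sup_le le_sup_left ?_)
      calc m ^ 2 = m * m := pow_two m
        _ ≤ m * (I ⊔ m ^ (k + 1)) := Ideal.mul_mono_right ih
        _ = m * I ⊔ m * m ^ (k + 1) := Ideal.mul_sup _ _ _
        _ ≤ I ⊔ m ^ (k + 1 + 1) := sup_le_sup Ideal.mul_le_right (by rw [← pow_succ'])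
  have hmI : m ≤ I :=
    (hpow n).trans (sup_le le_rfl ((Ideal.pow_le_pow_right (Nat.le_succ n)).trans hn))
  obtain ⟨i⟩ := ‹Nonempty σ›
  exact X_notMem_span_quadric N i (hmI (Ideal.subset_span (Set.mem_range_self i)))

end Quadrics

/-! ### Powers and the upper annihilator series. -/

section Series

variable {K A : Type*} [Field K] [NonUnitalNonAssocRing A] [Module K A]

theorem power_add_two (k : ℕ) : power K A (k + 2) = ⨆ i : Fin (k + 1), Submodule.span K
    (Set.image2 (fun x y : A => x * y) (power K A (i.val + 1)) (power K A (k + 1 - i.val))) := by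
  rw [power]

theorem power_one : power K A 1 = ⊤ := by rw [power]

theorem power_add_two_le {k : ℕ} {P : Submodule K A}
    (h : ∀ i j, i + j = k → ∀ x ∈ power K A (i + 1), ∀ y ∈ power K A (j + 1), x * y ∈ P) :
    power K A (k + 2) ≤ P := by
  rw [power_add_two]
  refine iSup_le fun i => Submodule.span_le.2 ?_
  rintro _ ⟨x, hx, y, hy, rfl⟩
  refine h i (k - i) (by omega) x hx y ?_
  have : k + 1 - i.val = k - i.val + 1 := by omega
  rwa [this] at hy

theorem mul_mem_power {i j : ℕ} {x y : A} (hx : x ∈ power K A (i + 1))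
    (hy : y ∈ power K A (j + 1)) : x * y ∈ power K A (i + j + 2) := by
  rw [power_add_two]
  refine Submodule.mem_iSup_of_mem (⟨i, by omega⟩ : Fin (i + j + 1))
    (Submodule.subset_span ⟨x, hx, y, ?_, rfl⟩)
  have : i + j + 1 - i = j + 1 := by omega
  rwa [this]

theorem mul_mem_power_two (x y : A) : x * y ∈ power K A 2 :=
  mul_mem_power (i := 0) (j := 0) (by rw [power_one]; trivial) (by rw [power_one]; trivial)

theorem power_succ_le (k : ℕ) : power K A (k + 2) ≤ power K A (k + 1) := by
  induction k using Nat.strong_induction_on with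
  | _ k ih =>
    refine power_add_two_le fun i j hij x hx y hy => ?_
    rcases i with _ | i
    · rcases j with _ | j
      · obtain rfl : k = 0 := by omega
        rw [power_one]; trivial
      · obtain rfl : k = j + 1 := by omega
        have := mul_mem_power hx (ih j (by omega) hy)
        rwa [zero_add] at this
    · obtain rfl : k = i + j + 1 := by omega
      exact mul_mem_power (ih i (by omega) hx) hy

theorem power_antitone {i j : ℕ} (h : i ≤ j) : power K A (j + 1) ≤ power K A (i + 1) := by
  induction h with
  | refl => exact le_rfl
  | step _ ih => exact (power_succ_le _).trans ih

/-- Iterated squares `x, x², (x²)², …`. -/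
def iterSq (x : A) : ℕ → A
  | 0 => x
  | k + 1 => iterSq x k * iterSq x k

theorem iterSq_mem_power (x : A) (k : ℕ) : iterSq x k ∈ power K A (2 ^ k) := by
  induction k with
  | zero => rw [pow_zero, power_one]; trivial
  | succ k ih =>
    obtain ⟨m, hm⟩ : ∃ m, 2 ^ k = m + 1 := ⟨2 ^ k - 1, by have := Nat.one_le_two_pow (n := k); omega⟩
    rw [hm] at ih
    have h2 : 2 ^ (k + 1) = m + m + 2 := by rw [pow_succ, hm]; ring
    rw [h2]
    exact mul_mem_power ih ih

variable [IsScalarTower K A A]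

variable (K A) in
/-- The upper annihilator series: `0`, then the elements all of whose products lie in the previous
term. -/
def annSeries : ℕ → Submodule K A
  | 0 => ⊥
  | k + 1 =>
    { carrier := {x | ∀ y, x * y ∈ annSeries k}
      add_mem' := fun ha hb y => by rw [add_mul]; exact add_mem (ha y) (hb y)
      zero_mem' := fun y => by rw [zero_mul]; exact zero_mem _
      smul_mem' := fun c x hx y => by rw [smul_mul_assoc]; exact Submodule.smul_mem _ _ (hx y) }

theorem mem_annSeries_succ {k : ℕ} {x : A} :
    x ∈ annSeries K A (k + 1) ↔ ∀ y, x * y ∈ annSeries K A k := Iff.rfl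

theorem mem_annSeries_one {x : A} : x ∈ annSeries K A 1 ↔ ∀ y, x * y = 0 := by
  rw [mem_annSeries_succ]
  exact forall_congr' fun y => Submodule.mem_bot K

theorem annSeries_le_succ (k : ℕ) : annSeries K A k ≤ annSeries K A (k + 1) := by
  induction k with
  | zero => exact bot_le
  | succ k ih => exact fun x hx y => ih (hx y)

theorem annSeries_mono : Monotone (annSeries K A) := monotone_nat_of_le_succ annSeries_le_succ

theorem mul_mem_annSeries {k : ℕ} {x : A} (hx : x ∈ annSeries K A k) (y : A) :
    x * y ∈ annSeries K A k := annSeries_le_succ k hx y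

/-- A product of total degree `2^(j+1) + 1` has a factor of degree at least `2^j + 1`, which lies
one level higher by induction; commutativity allows it to be on either side. -/
theorem power_le_annSeries (hc : ∀ x y : A, x * y = y * x) (j m : ℕ)
    (h : annSeries K A (m + j + 1) = ⊤) : power K A (2 ^ j + 1) ≤ annSeries K A m := by
  induction j generalizing m with
  | zero =>
    refine power_add_two_le fun i j _ x _ y _ => ?_
    exact Submodule.eq_top_iff'.1 h x y
  | succ j ih =>
    have ih := ih (m + 1) (by rw [← h]; congr 1; omega)
    obtain ⟨k, hk⟩ : ∃ k, 2 ^ j = k + 1 := ⟨2 ^ j - 1, by have := Nat.one_le_two_pow (n := j); omega⟩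
    have h2 : 2 ^ (j + 1) + 1 = 2 * k + 1 + 2 := by rw [pow_succ, hk]; ring
    rw [h2]
    rw [hk] at ih
    refine power_add_two_le fun a b hab x hx y hy => ?_
    by_cases ha : k + 1 ≤ a
    · exact ih (power_antitone ha hx) y
    · rw [hc]
      exact ih (power_antitone (by omega : k + 1 ≤ b) hy) x

theorem power_eq_bot_of_annSeries_eq_top (hc : ∀ x y : A, x * y = y * x) {s : ℕ}
    (h : annSeries K A (s + 1) = ⊤) : power K A (2 ^ s + 1) = ⊥ :=
  le_bot_iff.1 (power_le_annSeries hc s 0 (by rwa [zero_add]))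

theorem isNilpotentAlgebra_of_annSeries_eq_top (hc : ∀ x y : A, x * y = y * x) {s : ℕ}
    (h : annSeries K A s = ⊤) : IsNilpotentAlgebra K A :=
  ⟨2 ^ s + 1, Nat.succ_pos _, power_eq_bot_of_annSeries_eq_top hc
    (top_le_iff.1 (h.symm.le.trans (annSeries_le_succ s)))⟩

/-- An element outside a stable term has a product outside it; repeated multiplication then gives
nonzero elements in all powers. -/
theorem annSeries_eq_top_of_stable (hn : IsNilpotentAlgebra K A) {k : ℕ}
    (h : annSeries K A (k + 1) ≤ annSeries K A k) : annSeries K A k = ⊤ := by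
  obtain ⟨n, hn1, hn⟩ := hn
  by_contra hne
  obtain ⟨x, hx⟩ : ∃ x, x ∉ annSeries K A k := by
    by_contra hcon
    push Not at hcon
    exact hne ((Submodule.eq_top_iff').2 hcon)
  have : ∀ j, ∃ z ∈ power K A (j + 1), z ∉ annSeries K A k := by
    intro j
    induction j with
    | zero => exact ⟨x, by rw [power_one]; trivial, hx⟩
    | succ j ih =>
      obtain ⟨z, hz, hz'⟩ := ih
      obtain ⟨y, hy⟩ : ∃ y, z * y ∉ annSeries K A k := by
        by_contra hcon
        push Not at hcon
        exact hz' (h hcon)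
      exact ⟨z * y, mul_mem_power (j := 0) hz (by rw [power_one]; trivial), hy⟩
  obtain ⟨z, hz, hz'⟩ := this (n - 1)
  rw [Nat.sub_add_cancel hn1, hn, Submodule.mem_bot] at hz
  exact hz' (hz ▸ zero_mem _)

theorem finrank_annSeries_lt [FiniteDimensional K A] (hn : IsNilpotentAlgebra K A) {k : ℕ}
    (h : annSeries K A k ≠ ⊤) :
    Module.finrank K (annSeries K A k) < Module.finrank K (annSeries K A (k + 1)) :=
  Submodule.finrank_lt_finrank_of_lt ((annSeries_le_succ k).lt_of_not_ge
    fun h' => h (annSeries_eq_top_of_stable hn h'))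

theorem annSeries_eq_top_or_add_le_finrank [FiniteDimensional K A] (hn : IsNilpotentAlgebra K A)
    (k j : ℕ) : annSeries K A (k + j) = ⊤ ∨
      Module.finrank K (annSeries K A k) + j ≤ Module.finrank K (annSeries K A (k + j)) := by
  induction j with
  | zero => exact Or.inr le_rfl
  | succ j ih =>
    by_cases h : annSeries K A (k + j) = ⊤
    · exact Or.inl (top_le_iff.1 (h.symm.le.trans (annSeries_le_succ _)))
    · have h1 := ih.resolve_left h
      have h2 := finrank_annSeries_lt hn h
      exact Or.inr (by rw [← add_assoc k j 1]; omega)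

theorem annSeries_add_eq_top [FiniteDimensional K A] (hn : IsNilpotentAlgebra K A) {k j : ℕ}
    (h : Module.finrank K A ≤ Module.finrank K (annSeries K A k) + j) :
    annSeries K A (k + j) = ⊤ := by
  rcases annSeries_eq_top_or_add_le_finrank hn k j with h' | h'
  · exact h'
  · exact Submodule.eq_top_of_finrank_eq (le_antisymm (Submodule.finrank_le _) (h.trans h'))

theorem annSeries_finrank_eq_top [FiniteDimensional K A] (hn : IsNilpotentAlgebra K A) :
    annSeries K A (Module.finrank K A) = ⊤ := by
  have := annSeries_add_eq_top hn (k := 0) (j := Module.finrank K A) (Nat.le_add_left _ _)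
  rwa [zero_add] at this

end Series

/-! ### Consequences of adapted bases. -/

section Adapted

variable {K A : Type*} [Field K] [NonUnitalNonAssocRing A] [Module K A]
  [SMulCommClass K A A] [IsScalarTower K A A]

/-- Every subalgebra has a natural basis, each element `b` of which satisfies `b A ⊆ K b²`. -/
def HasAdaptedBases (K A : Type*) [Field K] [NonUnitalNonAssocRing A] [Module K A] : Prop :=
  ∀ S : NonUnitalSubalgebra K A, ∃ B : Set A, IsNaturalBasisOf K S.toSubmodule B ∧
    ∀ b ∈ B, ∀ y : A, b * y ∈ Submodule.span K {b * b}

theorem IsEvolutionAlgebra.mul_comm (h : IsEvolutionAlgebra K A) (x y : A) : x * y = y * x := by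
  obtain ⟨B, hB⟩ := h
  have hspan : ∀ z : A, z ∈ Submodule.span K B := fun z => by rw [hB.span_eq]; trivial
  induction hspan x using Submodule.span_induction with
  | mem x hx =>
    induction hspan y using Submodule.span_induction with
    | mem y hy =>
      by_cases hxy : x = y
      · rw [hxy]
      · rw [hB.mul_eq_zero x hx y hy hxy, hB.mul_eq_zero y hy x hx (Ne.symm hxy)]
    | zero => simp
    | add y z _ _ h1 h2 => rw [mul_add, add_mul, h1, h2]
    | smul c y _ h => rw [mul_smul_comm, smul_mul_assoc, h]
  | zero => simp
  | add y z _ _ h1 h2 => rw [mul_add, add_mul, h1, h2]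
  | smul c y _ h => rw [mul_smul_comm, smul_mul_assoc, h]

theorem IsNaturalBasisOf.exists_basis {B : Set A} (hB : IsNaturalBasisOf K (⊤ : Submodule K A) B) :
    ∃ b : Module.Basis B K A, (∀ i, b i = i) ∧ ∀ i j, i ≠ j → b i * b j = 0 := by
  have hli : LinearIndependent K ((↑) : B → A) := hB.linearIndepOn
  refine ⟨Module.Basis.mk hli (by rw [Subtype.range_coe, hB.span_eq]), fun i => by simp,
    fun i j hij => ?_⟩
  simp only [Module.Basis.mk_apply]
  exact hB.mul_eq_zero _ i.2 _ j.2 (fun h => hij (Subtype.ext h))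

theorem IsEvolutionAlgebra.exists_basis (h : IsEvolutionAlgebra K A) :
    ∃ (B : Set A) (b : Module.Basis B K A), ∀ i j, i ≠ j → b i * b j = 0 := by
  obtain ⟨B, hB⟩ := h
  obtain ⟨b, -, hb⟩ := hB.exists_basis
  exact ⟨B, b, hb⟩

/-- An element of a natural basis of the whole algebra is annihilated by all other basis vectors.
Unlike the extension property itself, the resulting condition passes directly to subalgebras. -/
theorem IsCompleteEvolutionAlgebra.hasAdaptedBases (h : IsCompleteEvolutionAlgebra K A) :
    HasAdaptedBases K A := by
  intro S
  obtain ⟨B, B', hB, hsub, hB'⟩ := h.2 S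
  refine ⟨B, hB, fun b hb y => ?_⟩
  have hy : y ∈ Submodule.span K B' := by rw [hB'.span_eq]; trivial
  induction hy using Submodule.span_induction with
  | mem y hy =>
    by_cases hby : b = y
    · rw [← hby]; exact Submodule.mem_span_singleton_self _
    · rw [hB'.mul_eq_zero b (hsub hb) y hy hby]; exact zero_mem _
  | zero => rw [mul_zero]; exact zero_mem _
  | add y z _ _ h1 h2 => rw [mul_add]; exact add_mem h1 h2
  | smul c y _ h => rw [mul_smul_comm]; exact Submodule.smul_mem _ _ h

theorem HasAdaptedBases.isEvolutionAlgebra (h : HasAdaptedBases K A) : IsEvolutionAlgebra K A := by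
  obtain ⟨B, hB, -⟩ := h ⊤
  exact ⟨B, hB⟩

theorem HasAdaptedBases.subalgebra (h : HasAdaptedBases K A) (S : NonUnitalSubalgebra K A) :
    HasAdaptedBases K S := by
  intro T
  obtain ⟨B, hB, hB'⟩ := h (T.map (NonUnitalSubalgebraClass.subtype S))
  have hBS : ∀ b ∈ B, ∃ hb : b ∈ S, (⟨b, hb⟩ : S) ∈ T := by
    intro b hb
    have : b ∈ Submodule.span K B := Submodule.subset_span hb
    rw [hB.span_eq] at this
    obtain ⟨t, ht, rfl⟩ := this
    exact ⟨t.2, ht⟩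
  refine ⟨Subtype.val ⁻¹' B, ⟨?_, ?_, ?_⟩, ?_⟩
  · refine LinearIndependent.of_comp S.toSubmodule.subtype ?_
    have hli : LinearIndependent K ((↑) : B → A) := hB.linearIndepOn
    exact hli.comp (fun x : (Subtype.val ⁻¹' B : Set S) => (⟨x.1.1, x.2⟩ : B))
      fun x y hxy => Subtype.ext (Subtype.ext (congrArg (fun b : B => (b : A)) hxy))
  · apply Submodule.map_injective_of_injective (f := S.toSubmodule.subtype) Subtype.val_injective
    rw [Submodule.map_span]
    have him : S.toSubmodule.subtype '' (Subtype.val ⁻¹' B) = B := by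
      ext b
      constructor
      · rintro ⟨x, hx, rfl⟩; exact hx
      · intro hb; exact ⟨⟨b, (hBS b hb).1⟩, hb, rfl⟩
    exact (congrArg (Submodule.span K) him).trans hB.span_eq
  · intro x hx y hy hxy
    exact Subtype.ext (hB.mul_eq_zero _ hx _ hy fun h => hxy (Subtype.ext h))
  · intro b hb y
    obtain ⟨c, hc⟩ := Submodule.mem_span_singleton.1 (hB' b hb y)
    exact Submodule.mem_span_singleton.2 ⟨c, Subtype.ext hc⟩

/-- A subspace closed under products, as a subalgebra. -/
def subalgebraOfSubmodule (P : Submodule K A) (h : ∀ x ∈ P, ∀ y ∈ P, x * y ∈ P) :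
    NonUnitalSubalgebra K A :=
  { P with mul_mem' := fun {x y} hx hy => h x hx y hy }

/-- Every subalgebra is an ideal, because `b A ⊆ K b²` and `b²` stays in the subalgebra. -/
theorem HasAdaptedBases.mul_mem (h : HasAdaptedBases K A) (S : NonUnitalSubalgebra K A) {x : A}
    (hx : x ∈ S) (y : A) : x * y ∈ S := by
  obtain ⟨B, hB, hB'⟩ := h S
  have hx' : x ∈ Submodule.span K B := by rw [hB.span_eq]; exact hx
  clear hx
  change x * y ∈ S.toSubmodule
  induction hx' using Submodule.span_induction with
  | mem b hb =>
    have hbS : b ∈ S.toSubmodule := hB.span_eq ▸ Submodule.subset_span hb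
    exact (Submodule.span_singleton_le_iff_mem _ _).2 (S.mul_mem hbS hbS) (hB' b hb y)
  | zero => rw [zero_mul]; exact zero_mem _
  | add y z _ _ h1 h2 => rw [add_mul]; exact add_mem h1 h2
  | smul c y _ h => rw [smul_mul_assoc]; exact Submodule.smul_mem _ _ h

/-- `K x + I` is a subalgebra with all products in `I`, so its adapted basis vectors satisfy `b A ⊆
K b² ⊆ I`. -/
theorem HasAdaptedBases.mul_mem_of_sq_mem (h : HasAdaptedBases K A) {I : Submodule K A}
    (hI : ∀ x ∈ I, ∀ y, x * y ∈ I) {x : A} (hx : x * x ∈ I) (y : A) : x * y ∈ I := by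
  have hc := h.isEvolutionAlgebra.mul_comm
  have key : ∀ u ∈ Submodule.span K {x} ⊔ I, ∀ v ∈ Submodule.span K {x} ⊔ I, u * v ∈ I := by
    intro u hu v hv
    obtain ⟨_, hu', i, hi, rfl⟩ := Submodule.mem_sup.1 hu
    obtain ⟨c, rfl⟩ := Submodule.mem_span_singleton.1 hu'
    obtain ⟨_, hv', j, hj, rfl⟩ := Submodule.mem_sup.1 hv
    obtain ⟨d, rfl⟩ := Submodule.mem_span_singleton.1 hv'
    rw [add_mul, mul_add]
    refine add_mem (add_mem ?_ ?_) (hI i hi _)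
    · rw [smul_mul_assoc, mul_smul_comm]
      exact Submodule.smul_mem _ _ (Submodule.smul_mem _ _ hx)
    · rw [hc]; exact hI j hj _
  obtain ⟨B, hB, hB'⟩ := h (subalgebraOfSubmodule (Submodule.span K {x} ⊔ I)
    fun u hu v hv => Submodule.mem_sup_right (key u hu v hv))
  have hspan : Submodule.span K B = Submodule.span K {x} ⊔ I := hB.span_eq
  have hxB : x ∈ Submodule.span K B := by
    rw [hspan]; exact Submodule.mem_sup_left (Submodule.mem_span_singleton_self _)
  have hall : ∀ z ∈ Submodule.span K B, z * y ∈ I := by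
    intro z hz
    induction hz using Submodule.span_induction with
    | mem b hb =>
      have hb' : b ∈ Submodule.span K {x} ⊔ I := hspan ▸ Submodule.subset_span hb
      exact (Submodule.span_singleton_le_iff_mem _ _).2 (key b hb' b hb') (hB' b hb y)
    | zero => rw [zero_mul]; exact zero_mem _
    | add y z _ _ h1 h2 => rw [add_mul]; exact add_mem h1 h2
    | smul c y _ h => rw [smul_mul_assoc]; exact Submodule.smul_mem _ _ h
  exact hall x hxB

theorem HasAdaptedBases.mul_mem_span_of_idempotent (h : HasAdaptedBases K A) {e : A}
    (he : e * e = e) (y : A) : e * y ∈ Submodule.span K {e} := by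
  refine h.mul_mem (subalgebraOfSubmodule (Submodule.span K {e}) ?_)
    (Submodule.mem_span_singleton_self e) y
  intro u hu v hv
  obtain ⟨c, rfl⟩ := Submodule.mem_span_singleton.1 hu
  obtain ⟨d, rfl⟩ := Submodule.mem_span_singleton.1 hv
  rw [smul_mul_assoc, mul_smul_comm, he]
  exact Submodule.smul_mem _ _ (Submodule.smul_mem _ _ (Submodule.mem_span_singleton_self e))

/-- The product `e f` lies in both `K e` and `K f`. If it is nonzero, `e` and `f` are proportional,
hence equal. If it is zero, `e + f` is an idempotent and `e = (e + f) e` would be a multiple of `e +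
f`. -/
theorem HasAdaptedBases.idempotent_unique (h : HasAdaptedBases K A) {e f : A} (he : e * e = e)
    (hf : f * f = f) (he0 : e ≠ 0) (hf0 : f ≠ 0) : e = f := by
  have hc := h.isEvolutionAlgebra.mul_comm
  obtain ⟨a, ha⟩ := Submodule.mem_span_singleton.1 (h.mul_mem_span_of_idempotent he f)
  obtain ⟨b, hb⟩ := Submodule.mem_span_singleton.1 (h.mul_mem_span_of_idempotent hf e)
  rw [hc f e, ← ha] at hb
  by_cases ha0 : a = 0
  · exfalso
    have hef : e * f = 0 := by rw [← ha, ha0, zero_smul]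
    have hfe : f * e = 0 := by rw [hc, hef]
    have hid : (e + f) * (e + f) = e + f := by
      rw [add_mul, mul_add, mul_add, he, hf, hef, hfe, add_zero, zero_add]
    obtain ⟨g, hg⟩ := Submodule.mem_span_singleton.1 (h.mul_mem_span_of_idempotent hid e)
    rw [add_mul, he, hfe, add_zero] at hg
    have h2 := congrArg (· * f) hg
    simp only [smul_mul_assoc, add_mul, hef, hf, zero_add] at h2
    rw [(smul_eq_zero.1 h2).resolve_right hf0, zero_smul] at hg
    exact he0 hg.symm
  · have h1 : e = (a⁻¹ * b) • f := by rw [mul_smul, hb, smul_smul, inv_mul_cancel₀ ha0, one_smul]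
    set c := a⁻¹ * b
    have hc0 : c ≠ 0 := by
      intro h0; rw [h0, zero_smul] at h1; exact he0 h1
    rw [h1, smul_mul_assoc, mul_smul_comm, hf, smul_smul] at he
    have h3 : c * c = c := smul_left_injective K hf0 he
    have h4 : c = 1 := mul_left_cancel₀ hc0 (by rw [h3, mul_one])
    rw [h1, h4, one_smul]

theorem HasAdaptedBases.mem_annSeries_of_sq_mem (h : HasAdaptedBases K A) {k : ℕ} {x : A}
    (hx : x * x ∈ annSeries K A k) : x ∈ annSeries K A (k + 1) :=
  fun y => h.mul_mem_of_sq_mem (fun _ hu v => mul_mem_annSeries hu v) hx y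

/-- Each squaring descends at most one level of the annihilator series. -/
theorem HasAdaptedBases.iterSq_notMem (h : HasAdaptedBases K A) {k : ℕ} (j : ℕ) {x : A}
    (hx : x ∉ annSeries K A (k + j)) : iterSq x j ∉ annSeries K A k := by
  induction j generalizing k with
  | zero => exact hx
  | succ j ih =>
    intro h'
    exact ih (k := k + 1) (by rwa [add_right_comm, add_assoc]) (h.mem_annSeries_of_sq_mem h')

theorem HasAdaptedBases.power_ne_bot (h : HasAdaptedBases K A) {k : ℕ}
    (hk : annSeries K A k ≠ ⊤) : power K A (2 ^ k) ≠ ⊥ := by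
  intro hbot
  refine hk (Submodule.eq_top_iff'.2 fun x => ?_)
  by_contra hx
  refine h.iterSq_notMem (k := 0) k (by rwa [zero_add]) ?_
  have := iterSq_mem_power (K := K) x k
  rw [hbot] at this
  exact this

end Adapted

/-! ### Splitting off an idempotent. -/

section Idempotent

variable {K A : Type*} [Field K] [NonUnitalNonAssocRing A] [Module K A]
  [SMulCommClass K A A] [IsScalarTower K A A]

theorem mul_basis_apply {ι : Type*} [Fintype ι] (b : Module.Basis ι K A)
    (hb : ∀ i j, i ≠ j → b i * b j = 0) (x : A) (i : ι) :
    x * b i = b.repr x i • (b i * b i) := by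
  conv_lhs => rw [← b.sum_repr x]
  rw [Finset.sum_mul, Finset.sum_eq_single i]
  · rw [smul_mul_assoc]
  · intro j _ hj; rw [smul_mul_assoc, hb j i hj, smul_zero]
  · simp

theorem sum_smul_mul_self {ι : Type*} [Fintype ι] (b : ι → A)
    (hb : ∀ i j, i ≠ j → b i * b j = 0) (w : ι → K) :
    (∑ i, w i • b i) * (∑ i, w i • b i) = ∑ i, w i ^ 2 • (b i * b i) := by
  rw [Finset.sum_mul_sum]
  refine Finset.sum_congr rfl fun i _ => ?_
  rw [Finset.sum_eq_single i]
  · rw [smul_mul_smul_comm, pow_two]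
  · intro j _ hj; rw [smul_mul_smul_comm, hb i j hj.symm, smul_zero]
  · simp

theorem mem_iff_of_coordinate {ι : Type*} [Fintype ι] (b : Module.Basis ι K A)
    {I : Submodule K A} (hI : ∀ x ∈ I, ∀ i, b.repr x i • b i ∈ I) {x : A} :
    x ∈ I ↔ ∀ i, b i ∉ I → b.repr x i = 0 := by
  constructor
  · intro hx i hi
    by_contra h0
    exact hi ((Submodule.smul_mem_iff _ h0).1 (hI x hx i))
  · intro h
    rw [← b.sum_repr x]
    refine sum_mem fun i _ => ?_
    by_cases hi : b i ∈ I
    · exact Submodule.smul_mem _ _ hi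
    · rw [h i hi, zero_smul]; exact zero_mem _

/-- Modulo a coordinate subspace `I` such that `x² ∈ I` only for `x ∈ I`, there is a nonzero
idempotent. -/
theorem exists_idempotent_mod [IsAlgClosed K] {ι : Type*} [Fintype ι] (b : Module.Basis ι K A)
    (hb : ∀ i j, i ≠ j → b i * b j = 0) {I : Submodule K A}
    (hI : ∀ x ∈ I, ∀ i, b.repr x i • b i ∈ I) (hsq : ∀ x, x * x ∈ I → x ∈ I) (hne : I ≠ ⊤) :
    ∃ x, x ∉ I ∧ x * x - x ∈ I := by
  classical
  -- These basis vectors represent a basis of the quotient by `I`, and `M` below is the matrix of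
  -- their squares there.
  let J := {i // b i ∉ I}
  have hJ : Nonempty J := by
    by_contra hemp
    refine hne (Submodule.eq_top_iff'.2 fun x => (mem_iff_of_coordinate b hI).2 fun i hi => ?_)
    exact absurd ⟨⟨i, hi⟩⟩ hemp
  have hbJ : ∀ i j : J, i ≠ j → b i * b j = 0 := fun i j hij => hb i j fun h => hij (Subtype.ext h)
  let M : Matrix J J K := fun j k => b.repr (b j * b j) k
  have hrepr : ∀ (w : J → K) (k : J), b.repr (∑ j, w j • b j) k = w k := by
    intro w k
    simp only [map_sum, map_smul, Module.Basis.repr_self, Finsupp.smul_single, smul_eq_mul, mul_one,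
      Finsupp.coe_finsetSum, Finset.sum_apply]
    rw [Finset.sum_eq_single k]
    · simp
    · intro j _ hj
      exact Finsupp.single_eq_of_ne fun h => hj (Subtype.ext h.symm)
    · simp
  have hreprsq : ∀ (w : J → K) (k : J),
      b.repr (∑ j, w j • (b j * b j)) k = Matrix.vecMul w M k := by
    intro w k
    simp only [map_sum, map_smul, Finsupp.coe_finsetSum, Finset.sum_apply, Finsupp.smul_apply,
      smul_eq_mul]
    rfl
  -- A left kernel vector `v` of `M`, with square roots `w` of its entries, gives an element `∑ w_j
  -- b_j` whose square lies in `I`; hence `w = 0`.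
  have hM : IsUnit M := by
    rw [← Matrix.vecMul_injective_iff_isUnit]
    rw [← Matrix.coe_vecMulLinear, ← LinearMap.ker_eq_bot, LinearMap.ker_eq_bot']
    intro v hv
    choose w hw using fun j => IsAlgClosed.exists_pow_nat_eq (v j) (n := 2) (by norm_num)
    have hx := hsq (∑ j, w j • b j) (by
      rw [sum_smul_mul_self (fun j : J => b j) hbJ w, mem_iff_of_coordinate b hI]
      intro k hk
      simp only [hw]
      rw [hreprsq v ⟨k, hk⟩]
      exact congrFun hv _)
    rw [mem_iff_of_coordinate b hI] at hx
    funext j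
    have := hx j j.2
    rw [hrepr] at this
    rw [← hw j, this]
    simp
  have hdet : IsUnit M.det := (Matrix.isUnit_iff_isUnit_det M).1 hM
  -- Idempotency modulo `I` reads `(x_j²) M = x`, that is, `x_j² = (x M⁻¹)_j`.
  obtain ⟨x, hx0, hx⟩ := exists_sq_eq_vecMul M⁻¹ M (Matrix.nonsing_inv_mul M hdet)
  refine ⟨∑ j, x j • b j, fun hmem => hx0 ?_, ?_⟩
  · rw [mem_iff_of_coordinate b hI] at hmem
    funext j
    rw [← hrepr x j]
    exact hmem j j.2
  · rw [mem_iff_of_coordinate b hI]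
    intro k hk
    rw [map_sub, Finsupp.sub_apply, hrepr x ⟨k, hk⟩, sum_smul_mul_self (fun j : J => b j) hbJ x,
      hreprsq (fun j => x j ^ 2) ⟨k, hk⟩]
    rw [funext hx, Matrix.vecMul_vecMul, Matrix.nonsing_inv_mul M hdet, Matrix.vecMul_one, sub_self]

/-- The product of `x_i b_i` with `y` equals `x (y_i b_i)`, so membership of `x` passes to its
components. -/
theorem repr_smul_mem_annSeries {ι : Type*} [Fintype ι] (b : Module.Basis ι K A)
    (hb : ∀ i j, i ≠ j → b i * b j = 0) (hc : ∀ x y : A, x * y = y * x) {k : ℕ} {x : A}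
    (hx : x ∈ annSeries K A k) (i : ι) : b.repr x i • b i ∈ annSeries K A k := by
  cases k with
  | zero =>
    rw [(Submodule.mem_bot K).1 hx]
    simp
  | succ k =>
    intro y
    rw [smul_mul_assoc, hc, mul_basis_apply b hb, smul_comm, ← mul_basis_apply b hb]
    exact Submodule.smul_mem _ _ (hx _)

/-- Idempotents lift along the terms of the annihilator series. -/
theorem exists_idempotent_lift (hc : ∀ x y : A, x * y = y * x) (k : ℕ) (x : A)
    (hx : x * x - x ∈ annSeries K A k) : ∃ f : A, f * f = f ∧ f - x ∈ annSeries K A k := by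
  induction k generalizing x with
  | zero =>
    have : x * x - x = 0 := hx
    exact ⟨x, sub_eq_zero.1 this, by rw [sub_self]; exact zero_mem _⟩
  | succ k ih =>
    set a := x * x - x with ha
    have hxx : x * x = x + a := by rw [ha]; abel
    -- Replacing `x` by `x²` changes the defect `a` into `2 a x + a²`, which lies one level lower.
    obtain ⟨f, hf, hfx⟩ := ih (x * x) (by
      have : (x * x) * (x * x) - x * x = a * x + a * x + a * a := by
        conv_lhs => rw [hxx, add_mul, mul_add, mul_add, hxx, hc x a]
        abel
      rw [this]
      exact add_mem (add_mem (hx x) (hx x)) (hx a))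
    refine ⟨f, hf, ?_⟩
    have : f - x = (f - x * x) + a := by rw [ha]; abel
    rw [this]
    exact add_mem (annSeries_le_succ k hfx) hx

theorem exists_annSeries_stable [FiniteDimensional K A] :
    ∃ k, annSeries K A (k + 1) ≤ annSeries K A k := by
  obtain ⟨k, hk⟩ := monotone_stabilizes_iff_noetherian.2 (inferInstance : IsNoetherian K A)
    ⟨annSeries K A, annSeries_mono⟩
  exact ⟨k, (hk (k + 1) (Nat.le_succ k)).symm.le⟩

theorem annSeries_subalgebra_le (S : NonUnitalSubalgebra K A) (k : ℕ) :
    (annSeries K A k).comap S.toSubmodule.subtype ≤ annSeries K S k := by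
  induction k with
  | zero =>
    intro x hx
    have : (x : A) = 0 := hx
    exact Subtype.ext this
  | succ k ih => exact fun x hx y => ih (hx (y : A))

theorem exists_quadratic_root [IsAlgClosed K] [NeZero (2 : K)] (b c : K) :
    ∃ t : K, t * t + b * t + c = 0 := by
  obtain ⟨s, hs⟩ := IsAlgClosed.exists_eq_mul_self (discrim 1 b c)
  obtain ⟨t, ht⟩ := exists_quadratic_eq_zero (one_ne_zero (α := K)) ⟨s, hs⟩
  exact ⟨t, by rw [← ht, one_mul]⟩

theorem add_smul_idempotent_mul_self (hc : ∀ x y : A, x * y = y * x) {e x a : A} {l n t : K}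
    (he : e * e = e) (hx : x * x = a + l • e) (hxe : x * e = n • e) :
    (x + t • e) * (x + t • e) = a + (t * t + 2 * n * t + l) • e := by
  rw [add_mul, mul_add, mul_add, smul_mul_assoc, smul_mul_assoc, mul_smul_comm, mul_smul_comm,
    hc e x, hx, hxe, he]
  module

/-- A complete evolution algebra that is not nilpotent is the direct sum of a line spanned by an
idempotent and a nilpotent ideal. -/
theorem IsCompleteEvolutionAlgebra.exists_idempotent_decomposition [IsAlgClosed K]
    [NeZero (2 : K)] [FiniteDimensional K A] (h : IsCompleteEvolutionAlgebra K A)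
    (hn : ¬ IsNilpotentAlgebra K A) :
    ∃ (e : A) (N : NonUnitalSubalgebra K A), e * e = e ∧ e ≠ 0 ∧ (∀ x ∈ N, e * x = 0) ∧
      IsCompl (Submodule.span K {e}) N.toSubmodule ∧ IsNilpotentAlgebra K N := by
  have hW := h.hasAdaptedBases
  have hc := h.1.mul_comm
  obtain ⟨k, hk⟩ := exists_annSeries_stable (K := K) (A := A)
  set I := annSeries K A k with hIdef
  have hsqI : ∀ x, x * x ∈ I → x ∈ I := fun x hx => hk (hW.mem_annSeries_of_sq_mem hx)
  have hItop : I ≠ ⊤ := fun ht => hn (isNilpotentAlgebra_of_annSeries_eq_top hc ht)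
  obtain ⟨e, he, heI⟩ : ∃ e : A, e * e = e ∧ e ∉ I := by
    obtain ⟨B, b, hb⟩ := h.1.exists_basis
    have := Module.Finite.finite_basis b
    have := Fintype.ofFinite B
    obtain ⟨x, hx, hxx⟩ := exists_idempotent_mod b hb
      (fun x hx i => repr_smul_mem_annSeries b hb hc hx i) hsqI hItop
    obtain ⟨f, hf, hfx⟩ := exists_idempotent_lift hc k x hxx
    exact ⟨f, hf, fun hfI => hx (by simpa using sub_mem hfI hfx)⟩
  have he0 : e ≠ 0 := fun h0 => heI (h0 ▸ zero_mem _)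
  have heN : ∀ x ∈ I, e * x = 0 := by
    intro x hx
    obtain ⟨c, hcx⟩ := Submodule.mem_span_singleton.1 (hW.mul_mem_span_of_idempotent he x)
    have hmem : e * x ∈ I := by rw [hc]; exact mul_mem_annSeries hx e
    by_cases hc0 : c = 0
    · rw [← hcx, hc0, zero_smul]
    · rw [← hcx] at hmem
      exact absurd ((Submodule.smul_mem_iff _ hc0).1 hmem) heI
  -- Otherwise there is an idempotent outside `I + K e`, contradicting uniqueness.
  have htop : I ⊔ Submodule.span K {e} = ⊤ := by
    by_contra hne
    have hmem : ∀ {x}, x ∈ I ⊔ Submodule.span K {e} ↔ ∃ a ∈ I, ∃ l : K, x = a + l • e := by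
      intro x
      rw [Submodule.mem_sup]
      constructor
      · rintro ⟨a, ha, _, hy, rfl⟩
        obtain ⟨l, rfl⟩ := Submodule.mem_span_singleton.1 hy
        exact ⟨a, ha, l, rfl⟩
      · rintro ⟨a, ha, l, rfl⟩
        exact ⟨a, ha, _, Submodule.mem_span_singleton.2 ⟨l, rfl⟩, rfl⟩
    have hxe : ∀ x : A, ∃ n : K, x * e = n • e := by
      intro x
      obtain ⟨n, hn⟩ := Submodule.mem_span_singleton.1 (hW.mul_mem_span_of_idempotent he x)
      exact ⟨n, by rw [hc, hn]⟩
    have hshift : ∀ (x : A) (t : K), x + t • e ∈ I → x ∈ I ⊔ Submodule.span K {e} := by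
      intro x t hx
      exact hmem.2 ⟨_, hx, -t, by rw [neg_smul]; abel⟩
    -- Here the extension of bases is needed: a multiple of `e` belongs to a natural basis of the
    -- whole algebra, which makes `I + K e` a coordinate subspace.
    obtain ⟨C, B, hC, hCB, hB⟩ := h.2 (subalgebraOfSubmodule (Submodule.span K {e}) (by
      intro u hu v hv
      obtain ⟨c, rfl⟩ := Submodule.mem_span_singleton.1 hu
      obtain ⟨d, rfl⟩ := Submodule.mem_span_singleton.1 hv
      rw [smul_mul_assoc, mul_smul_comm, he]
      exact Submodule.smul_mem _ _ (Submodule.smul_mem _ _ (Submodule.mem_span_singleton_self e))))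
    have hCe : Submodule.span K C = Submodule.span K {e} := hC.span_eq
    obtain ⟨c₀, hc₀⟩ : C.Nonempty := by
      rw [Set.nonempty_iff_ne_empty]
      rintro rfl
      rw [Submodule.span_empty] at hCe
      exact he0 (Submodule.span_singleton_eq_bot.1 hCe.symm)
    obtain ⟨b, hbB, hb⟩ := hB.exists_basis
    have := Module.Finite.finite_basis b
    have := Fintype.ofFinite B
    let i₀ : B := ⟨c₀, hCB hc₀⟩
    obtain ⟨r, hr⟩ := Submodule.mem_span_singleton.1 (hCe ▸ Submodule.subset_span hc₀)
    have hbi : b i₀ = r • e := by rw [hbB, hr]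
    have hr0 : r ≠ 0 := by
      rintro rfl
      exact b.ne_zero i₀ (by rw [hbi, zero_smul])
    have hei : e = r⁻¹ • b i₀ := by rw [hbi, smul_smul, inv_mul_cancel₀ hr0, one_smul]
    have hcoord : ∀ x ∈ I ⊔ Submodule.span K {e}, ∀ i,
        b.repr x i • b i ∈ I ⊔ Submodule.span K {e} := by
      intro x hx i
      obtain ⟨a, ha, l, rfl⟩ := hmem.1 hx
      rw [map_add, Finsupp.add_apply, add_smul]
      refine add_mem (Submodule.mem_sup_left (repr_smul_mem_annSeries b hb hc ha i)) ?_
      by_cases hi : i = i₀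
      · refine Submodule.smul_mem _ _ (Submodule.mem_sup_right ?_)
        rw [hi, hbi]
        exact Submodule.smul_mem _ _ (Submodule.mem_span_singleton_self e)
      · have : b.repr (l • e) i = 0 := by
          rw [hei, map_smul, map_smul, b.repr_self, Finsupp.smul_apply, Finsupp.smul_apply,
            Finsupp.single_eq_of_ne hi, smul_zero, smul_zero]
        rw [this, zero_smul]
        exact zero_mem _
    have hsq : ∀ x, x * x ∈ I ⊔ Submodule.span K {e} → x ∈ I ⊔ Submodule.span K {e} := by
      intro x hx
      obtain ⟨a, ha, l, hal⟩ := hmem.1 hx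
      obtain ⟨n, hxn⟩ := hxe x
      -- The root `t` cancels the `e`-part of `(x + t e)²`, so that this square lies in `I`.
      obtain ⟨t, ht⟩ := exists_quadratic_root (2 * n) l
      refine hshift x t (hsqI _ ?_)
      rw [add_smul_idempotent_mul_self hc he hal hxn, ht, zero_smul, add_zero]
      exact ha
    obtain ⟨x, hx, hxx⟩ := exists_idempotent_mod b hb hcoord hsq hne
    obtain ⟨a, ha, l, hal⟩ := hmem.1 hxx
    obtain ⟨n, hxn⟩ := hxe x
    -- This `t` makes `x + t e` idempotent modulo `I`, not merely modulo `I + K e`, so that it can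
    -- be lifted.
    obtain ⟨t, ht⟩ := exists_quadratic_root (2 * n - 1) l
    have hal' : x * x = (a + x) + l • e := by rw [← sub_add_cancel (x * x) x, hal]; abel
    obtain ⟨f, hf, hfx⟩ := exists_idempotent_lift hc k (x + t • e) (by
      have : (a + x) + (t * t + 2 * n * t + l) • e - (x + t • e) =
          a + (t * t + (2 * n - 1) * t + l) • e := by module
      rw [add_smul_idempotent_mul_self hc he hal' hxn, this, ht, zero_smul, add_zero]
      exact ha)
    have hfI : f ∉ I ⊔ Submodule.span K {e} := by
      intro hf'
      refine hx ?_
      have : x = f - (f - (x + t • e)) - t • e := by abel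
      rw [this]
      exact sub_mem (sub_mem hf' (Submodule.mem_sup_left hfx))
        (Submodule.smul_mem _ _ (Submodule.mem_sup_right (Submodule.mem_span_singleton_self e)))
    have hf0 : f ≠ 0 := fun h0 => hfI (h0 ▸ zero_mem _)
    rw [← hW.idempotent_unique he hf he0 hf0] at hfI
    exact hfI (Submodule.mem_sup_right (Submodule.mem_span_singleton_self e))
  refine ⟨e, subalgebraOfSubmodule I fun x hx y _ => mul_mem_annSeries hx y, he, he0, heN,
    ⟨?_, ?_⟩, ?_⟩
  · rw [disjoint_comm, Submodule.disjoint_span_singleton' he0]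
    exact heI
  · rw [codisjoint_iff, sup_comm]
    exact htop
  · refine isNilpotentAlgebra_of_annSeries_eq_top (s := k) (fun x y => Subtype.ext (hc x y)) ?_
    exact Submodule.eq_top_iff'.2 fun x => annSeries_subalgebra_le _ k x.2

end Idempotent

/-! ### The structure of the nilpotent part. -/

section Nilpotent

variable {K A : Type*} [Field K] [NonUnitalNonAssocRing A] [Module K A]
  [SMulCommClass K A A] [IsScalarTower K A A]

theorem mem_annSeries_one_of_basis {ι : Type*} [Fintype ι] (b : Module.Basis ι K A) {x : A}
    (hx : ∀ i, x * b i = 0) : x ∈ annSeries K A 1 := by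
  refine mem_annSeries_one.2 fun y => ?_
  rw [← b.sum_repr y, Finset.mul_sum]
  exact Finset.sum_eq_zero fun i _ => by rw [mul_smul_comm, hx, smul_zero]

/-- The linear map sending every vector of a basis to its square. -/
noncomputable def evolutionOperator {ι : Type*} (b : Module.Basis ι K A) : A →ₗ[K] A :=
  b.constr K fun i => b i * b i

theorem evolutionOperator_basis {ι : Type*} (b : Module.Basis ι K A) (i : ι) :
    evolutionOperator b (b i) = b i * b i := b.constr_basis K _ i

theorem evolutionOperator_apply {ι : Type*} [Fintype ι] (b : Module.Basis ι K A) (x : A) :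
    evolutionOperator b x = ∑ i, b.repr x i • (b i * b i) := b.constr_apply_fintype K _ x

theorem power_two_le_range {ι : Type*} [Fintype ι] (b : Module.Basis ι K A)
    (hb : ∀ i j, i ≠ j → b i * b j = 0) :
    power K A 2 ≤ LinearMap.range (evolutionOperator b) := by
  refine power_add_two_le fun _ _ _ x _ y _ => ⟨∑ i, (b.repr y i * b.repr x i) • b i, ?_⟩
  rw [map_sum]
  conv_rhs => rw [← b.sum_repr y, Finset.mul_sum]
  refine Finset.sum_congr rfl fun i _ => ?_
  rw [map_smul, evolutionOperator_basis, mul_smul_comm, mul_basis_apply b hb x, mul_smul]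

/-- Taking square roots `w_i` of the coordinates of `x` gives an element of square zero, which
therefore annihilates the algebra. So `w_i b_i² = 0`, and then `x b_i = w_i² b_i² = 0`. -/
theorem HasAdaptedBases.ker_evolutionOperator_le [IsAlgClosed K] (hW : HasAdaptedBases K A)
    {ι : Type*} [Fintype ι] (b : Module.Basis ι K A) (hb : ∀ i j, i ≠ j → b i * b j = 0) :
    LinearMap.ker (evolutionOperator b) ≤ annSeries K A 1 := by
  intro x hx
  choose w hw using fun i => IsAlgClosed.exists_pow_nat_eq (b.repr x i) (n := 2) (by norm_num)
  have hsq : (∑ i, w i • b i) * (∑ i, w i • b i) ∈ annSeries K A 0 := by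
    rw [sum_smul_mul_self b hb]
    simp only [hw]
    rw [← evolutionOperator_apply]
    exact hx
  have hann := mem_annSeries_one.1 (hW.mem_annSeries_of_sq_mem hsq)
  refine mem_annSeries_one_of_basis b fun i => ?_
  have h := hann (b i)
  rw [mul_basis_apply b hb, b.repr_sum_self] at h
  rw [mul_basis_apply b hb, ← hw, pow_two, mul_smul, h, smul_zero]

/-- The operator is multiplication by `∑ b_i`, because `x b_i = x_i b_i²`. -/
theorem map_evolutionOperator_annSeries_le {ι : Type*} [Fintype ι] (b : Module.Basis ι K A)
    (hb : ∀ i j, i ≠ j → b i * b j = 0) (k : ℕ) :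
    (annSeries K A (k + 1)).map (evolutionOperator b) ≤ annSeries K A k := by
  rintro _ ⟨x, hx, rfl⟩
  rw [evolutionOperator_apply]
  refine sum_mem fun i _ => ?_
  rw [← mul_basis_apply b hb]
  exact hx _

theorem finrank_le_map_add_ker [FiniteDimensional K A] (f : A →ₗ[K] A) (P : Submodule K A) :
    Module.finrank K P ≤ Module.finrank K (P.map f) + Module.finrank K (LinearMap.ker f) := by
  have h := LinearMap.finrank_range_add_finrank_ker (f.domRestrict P)
  rw [LinearMap.range_domRestrict] at h
  rw [← h]
  refine Nat.add_le_add_left ?_ _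
  rw [← Submodule.finrank_map_subtype_eq]
  refine Submodule.finrank_mono ?_
  rintro _ ⟨x, hx, rfl⟩
  exact hx

/-- If the square of the algebra has codimension at most one, then the algebra has the largest
possible index of nilpotency. -/
theorem HasAdaptedBases.power_ne_bot_of_finrank_le [IsAlgClosed K] [FiniteDimensional K A]
    (hW : HasAdaptedBases K A) (hpos : 0 < Module.finrank K A)
    (hd : Module.finrank K A ≤ Module.finrank K (power K A 2) + 1) :
    power K A (2 ^ (Module.finrank K A - 1)) ≠ ⊥ := by
  obtain ⟨B, b, hb⟩ := hW.isEvolutionAlgebra.exists_basis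
  have := Module.Finite.finite_basis b
  have := Fintype.ofFinite B
  have hker : Module.finrank K (LinearMap.ker (evolutionOperator b)) ≤ 1 := by
    have h1 := LinearMap.finrank_range_add_finrank_ker (evolutionOperator b)
    have h2 := Submodule.finrank_mono (power_two_le_range b hb)
    omega
  -- The operator maps each term to the previous one with kernel of dimension at most one.
  have hle : ∀ k, Module.finrank K (annSeries K A k) ≤ k := by
    intro k
    induction k with
    | zero => exact (finrank_bot K A).le
    | succ k ih =>
      have h1 := finrank_le_map_add_ker (evolutionOperator b) (annSeries K A (k + 1))
      have h2 := Submodule.finrank_mono (map_evolutionOperator_annSeries_le b hb k)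
      omega
  refine hW.power_ne_bot fun htop => ?_
  have := hle (Module.finrank K A - 1)
  rw [htop, finrank_top] at this
  omega

/-- Modulo the annihilator and the square, the algebra is at most one-dimensional. -/
theorem HasAdaptedBases.exists_generator [IsAlgClosed K] [FiniteDimensional K A]
    (hW : HasAdaptedBases K A) :
    ∃ x : A, Submodule.span K {x} ⊔ (power K A 2 ⊔ annSeries K A 1) = ⊤ := by
  set M := power K A 2 ⊔ annSeries K A 1 with hM
  obtain ⟨B, b, hb⟩ := hW.isEvolutionAlgebra.exists_basis
  have := Module.Finite.finite_basis b
  have := Fintype.ofFinite B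
  -- An adapted basis of `K x + A²` has an element `s` outside `M`. Modulo the annihilator, `s`
  -- turns out to be a multiple of a single `b_i`.
  have hcover : ∀ x ∉ M, ∃ i, x ∈ Submodule.span K {b i} ⊔ M := by
    intro x hx
    obtain ⟨C, hC, hC'⟩ := hW (subalgebraOfSubmodule (Submodule.span K {x} ⊔ power K A 2)
      fun u _ v _ => Submodule.mem_sup_right (mul_mem_power_two u v))
    have hspan : Submodule.span K C = Submodule.span K {x} ⊔ power K A 2 := hC.span_eq
    obtain ⟨s, hsC, hsM⟩ : ∃ s ∈ C, s ∉ M := by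
      by_contra hcon
      push Not at hcon
      have hle : Submodule.span K C ≤ M := Submodule.span_le.2 hcon
      rw [hspan] at hle
      exact hx (hle (Submodule.mem_sup_left (Submodule.mem_span_singleton_self x)))
    obtain ⟨_, hy, w, hw, hs⟩ := Submodule.mem_sup.1 (hspan ▸ Submodule.subset_span hsC)
    obtain ⟨c, rfl⟩ := Submodule.mem_span_singleton.1 hy
    have hc0 : c ≠ 0 := by
      rintro rfl
      rw [zero_smul, zero_add] at hs
      exact hsM (hs ▸ Submodule.mem_sup_left hw)
    obtain ⟨i, hi⟩ : ∃ i, s * b i ≠ 0 := by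
      by_contra hcon
      push Not at hcon
      exact hsM (Submodule.mem_sup_right (mem_annSeries_one_of_basis b hcon))
    obtain ⟨β, hβ⟩ := Submodule.mem_span_singleton.1 (hC' s hsC (b i))
    have hβ0 : β ≠ 0 := by
      rintro rfl
      rw [zero_smul] at hβ
      exact hi hβ.symm
    -- Both `s b_i` and `s b_j` lie on the line `K s²`. A linear relation between them gives a
    -- kernel vector of the evolution operator, hence an annihilating combination of `b_i` and
    -- `b_j`.
    have hj : ∀ j, j ≠ i → s * b j = 0 := by
      intro j hji
      obtain ⟨α, hα⟩ := Submodule.mem_span_singleton.1 (hC' s hsC (b j))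
      have hrel : s * b j = (α * β⁻¹) • (s * b i) := by
        rw [← hβ, ← hα, smul_smul, mul_assoc, inv_mul_cancel₀ hβ0, mul_one]
      rw [mul_basis_apply b hb, mul_basis_apply b hb s i] at hrel
      have hkey : b.repr s j • b j - (α * β⁻¹) • b.repr s i • b i ∈
          LinearMap.ker (evolutionOperator b) := by
        rw [LinearMap.mem_ker, map_sub, map_smul, map_smul, map_smul, evolutionOperator_basis,
          evolutionOperator_basis, hrel, sub_self]
      have := mem_annSeries_one.1 (hW.ker_evolutionOperator_le b hb hkey) (b j)
      rw [sub_mul, smul_mul_assoc, smul_mul_assoc, smul_mul_assoc, hb i j hji.symm, smul_zero,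
        smul_zero, sub_zero] at this
      rw [mul_basis_apply b hb, this]
    have hann : s - b.repr s i • b i ∈ annSeries K A 1 := by
      refine mem_annSeries_one_of_basis b fun j => ?_
      rw [sub_mul, smul_mul_assoc]
      by_cases hji : j = i
      · rw [hji, mul_basis_apply b hb, sub_self]
      · rw [hj j hji, hb i j (Ne.symm hji), smul_zero, sub_zero]
    refine ⟨i, ?_⟩
    rw [← Submodule.smul_mem_iff _ hc0]
    have : c • x = b.repr s i • b i + ((s - b.repr s i • b i) - w) := by rw [← hs]; abel
    rw [this]
    exact Submodule.add_mem_sup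
      (Submodule.smul_mem _ _ (Submodule.mem_span_singleton_self _))
      (sub_mem (Submodule.mem_sup_right hann) (Submodule.mem_sup_left hw))
  by_cases hMtop : M = ⊤
  · exact ⟨0, by rw [hMtop, sup_top_eq]⟩
  · obtain ⟨x, hx⟩ : ∃ x, x ∉ M := by
      by_contra hcon
      push Not at hcon
      exact hMtop (Submodule.eq_top_iff'.2 hcon)
    obtain ⟨i₀, -⟩ := hcover x hx
    have : Infinite K := IsAlgClosed.instInfinite
    -- A vector space over an infinite field is not a finite union of proper subspaces.
    obtain ⟨i, hi⟩ := Subspace.exists_eq_top_of_iUnion_eq_univ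
      (p := fun i => Submodule.span K {b i} ⊔ M) (by
        refine Set.eq_univ_of_forall fun y => Set.mem_iUnion.2 ?_
        by_cases hy : y ∈ M
        · exact ⟨i₀, Submodule.mem_sup_right hy⟩
        · exact hcover y hy)
    exact ⟨b i, hi⟩

theorem finrank_span_singleton_sup_le [FiniteDimensional K A] (x : A) (P : Submodule K A) :
    Module.finrank K (Submodule.span K {x} ⊔ P : Submodule K A) ≤ Module.finrank K P + 1 := by
  have h1 := Submodule.finrank_add_le_finrank_add_finrank (Submodule.span K {x}) P
  have h2 := finrank_span_le_card (R := K) ({x} : Set A)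
  simp only [Set.toFinset_singleton, Finset.card_singleton] at h2
  omega

theorem IsNilpotentAlgebra.subalgebra [FiniteDimensional K A] (hn : IsNilpotentAlgebra K A)
    (hc : ∀ x y : A, x * y = y * x) (S : NonUnitalSubalgebra K A) : IsNilpotentAlgebra K S := by
  refine isNilpotentAlgebra_of_annSeries_eq_top (s := Module.finrank K A)
    (fun x y => Subtype.ext (hc x y)) (Submodule.eq_top_iff'.2 fun x => ?_)
  refine annSeries_subalgebra_le S _ ?_
  rw [annSeries_finrank_eq_top hn]
  trivial

/-- A nilpotent algebra all of whose subalgebras have adapted natural bases is the direct sum of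
a subalgebra with the largest possible index of nilpotency and an algebra with zero product, unless
all its products are zero. -/
theorem HasAdaptedBases.exists_nilpotent_decomposition [IsAlgClosed K] [FiniteDimensional K A]
    (hW : HasAdaptedBases K A) (hn : IsNilpotentAlgebra K A) (hne : ∃ x y : A, x * y ≠ 0) :
    ∃ (F : NonUnitalSubalgebra K A) (Z : Submodule K A), IsCompl F.toSubmodule Z ∧
      (∀ z ∈ Z, ∀ y, z * y = 0) ∧ 2 ≤ Module.finrank K F ∧ IsNilpotentAlgebra K F ∧
      power K F (2 ^ (Module.finrank K F - 1)) ≠ ⊥ := by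
  have hc := hW.isEvolutionAlgebra.mul_comm
  obtain ⟨x₀, hx₀⟩ := hW.exists_generator
  rw [← sup_assoc] at hx₀
  set P := Submodule.span K {x₀} ⊔ power K A 2 with hP
  let F : NonUnitalSubalgebra K A := subalgebraOfSubmodule P
    fun u _ v _ => Submodule.mem_sup_right (mul_mem_power_two u v)
  have : FiniteDimensional K F := FiniteDimensional.finiteDimensional_submodule F.toSubmodule
  obtain ⟨Q, hQ⟩ := exists_isCompl (P ⊓ annSeries K A 1)
  -- By the modular law; it yields a complement of `P` inside the annihilator.
  have hsup : P ⊓ annSeries K A 1 ⊔ Q ⊓ annSeries K A 1 = annSeries K A 1 := by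
    rw [← sup_inf_assoc_of_le Q (inf_le_right : P ⊓ annSeries K A 1 ≤ _), hQ.sup_eq_top, top_inf_eq]
  have hcompl : IsCompl P (Q ⊓ annSeries K A 1) := by
    constructor
    · rw [disjoint_iff, inf_comm Q, ← inf_assoc, hQ.inf_eq_bot]
    · rw [codisjoint_iff, eq_top_iff, ← hx₀]
      refine sup_le le_sup_left ?_
      conv_lhs => rw [← hsup]
      exact sup_le_sup_right inf_le_left _
  have hZ : ∀ z ∈ Q ⊓ annSeries K A 1, ∀ y, z * y = 0 := fun z hz => mem_annSeries_one.1 hz.2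
  -- The complement annihilates everything, so all products of `A` are already products in `F`.
  have hpow : power K A 2 ≤ (power K F 2).map F.toSubmodule.subtype := by
    refine power_add_two_le fun _ _ _ x _ y _ => ?_
    have hdec : ∀ x : A, ∃ f : F, ∃ z ∈ Q ⊓ annSeries K A 1, x = f + z := by
      intro x
      have hx : x ∈ P ⊔ Q ⊓ annSeries K A 1 := by rw [hcompl.sup_eq_top]; trivial
      obtain ⟨f, hf, z, hz, rfl⟩ := Submodule.mem_sup.1 hx
      exact ⟨⟨f, hf⟩, z, hz, rfl⟩
    obtain ⟨f, z, hz, rfl⟩ := hdec x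
    obtain ⟨g, w, hw, rfl⟩ := hdec y
    refine ⟨f * g, mul_mem_power_two f g, ?_⟩
    rw [add_mul, mul_add, hZ z hz, hc (f : A) w, hZ w hw, add_zero, add_zero]
    rfl
  have hpowrank : Module.finrank K (power K A 2) ≤ Module.finrank K (power K F 2) := by
    calc _ ≤ _ := Submodule.finrank_mono hpow
      _ = _ := Submodule.finrank_map_subtype_eq F.toSubmodule (power K F 2)
  have hFrank : Module.finrank K F ≤ Module.finrank K (power K F 2) + 1 :=
    (finrank_span_singleton_sup_le x₀ (power K A 2)).trans (Nat.add_le_add_right hpowrank 1)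
  have hFn : IsNilpotentAlgebra K F := hn.subalgebra hc F
  have hF2 : 2 ≤ Module.finrank K F := by
    by_contra hlt
    obtain ⟨x, y, hxy⟩ := hne
    have htop : annSeries K F 1 = ⊤ := by
      rw [eq_top_iff, ← annSeries_finrank_eq_top hFn]
      exact annSeries_mono (by omega)
    have hbot : power K F 2 ≤ ⊥ := power_add_two_le fun _ _ _ f _ g _ => by
      have hf : f ∈ annSeries K F 1 := by rw [htop]; trivial
      exact mem_annSeries_one.1 hf g
    have := hpow (mul_mem_power_two x y)
    rw [le_bot_iff.1 hbot, Submodule.map_bot] at this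
    exact hxy this
  exact ⟨F, Q ⊓ annSeries K A 1, hcompl, hZ, hF2, hFn,
    (hW.subalgebra F).power_ne_bot_of_finrank_le (by omega) hFrank⟩

end Nilpotent

/-! ### Isomorphisms and direct sums. -/

section Isomorphisms

variable {K A B C D : Type*} [Field K] [NonUnitalNonAssocRing A] [Module K A]
  [NonUnitalNonAssocRing B] [Module K B] [NonUnitalNonAssocRing C] [Module K C]
  [NonUnitalNonAssocRing D] [Module K D]

theorem Isomorphic.refl (K A : Type*) [Field K] [NonUnitalNonAssocRing A] [Module K A] :
    Isomorphic K A A := ⟨NonUnitalAlgHom.id K A, Function.bijective_id⟩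

theorem Isomorphic.symm (h : Isomorphic K A B) : Isomorphic K B A := by
  obtain ⟨f, hf⟩ := h
  obtain ⟨g, hl, hr⟩ := Function.bijective_iff_has_inverse.1 hf
  exact ⟨f.inverse g hl hr, Function.bijective_iff_has_inverse.2 ⟨f, hr, hl⟩⟩

theorem Isomorphic.trans (h : Isomorphic K A B) (h' : Isomorphic K B C) : Isomorphic K A C := by
  obtain ⟨f, hf⟩ := h
  obtain ⟨g, hg⟩ := h'
  exact ⟨g.comp f, hg.comp hf⟩

theorem Isomorphic.prod (h : Isomorphic K A B) (h' : Isomorphic K C D) :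
    Isomorphic K (A × C) (B × D) := by
  obtain ⟨f, hf⟩ := h
  obtain ⟨g, hg⟩ := h'
  exact ⟨(f.comp (NonUnitalAlgHom.fst K A C)).prod (g.comp (NonUnitalAlgHom.snd K A C)),
    hf.prodMap hg⟩

theorem map_mem_power (f : A →ₙₐ[K] B) (k : ℕ) {x : A} (hx : x ∈ power K A (k + 1)) :
    f x ∈ power K B (k + 1) := by
  induction k using Nat.strong_induction_on generalizing x with
  | _ k ih =>
    cases k with
    | zero => rw [power_one]; trivial
    | succ k =>
      have hle : power K A (k + 2) ≤ (power K B (k + 2)).comap (f : A →ₗ[K] B) := by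
        refine power_add_two_le fun i j hij x hx y hy => ?_
        have := mul_mem_power (ih i (by omega) hx) (ih j (by omega) hy)
        rw [hij, ← map_mul] at this
        exact this
      exact hle hx

theorem Isomorphic.power_eq_bot (h : Isomorphic K A B) {k : ℕ} (hk : 1 ≤ k)
    (hA : power K A k = ⊥) : power K B k = ⊥ := by
  obtain ⟨g, hg⟩ := h.symm
  obtain ⟨k, rfl⟩ : ∃ j, k = j + 1 := ⟨k - 1, by omega⟩
  refine (Submodule.eq_bot_iff _).2 fun x hx => hg.1 ?_
  have := map_mem_power g k hx
  rw [hA, Submodule.mem_bot] at this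
  rw [this, map_zero]

theorem Isomorphic.isNilpotentAlgebra (h : Isomorphic K A B) (hA : IsNilpotentAlgebra K A) :
    IsNilpotentAlgebra K B := by
  obtain ⟨k, hk, hA⟩ := hA
  exact ⟨k, hk, h.power_eq_bot hk hA⟩

theorem Isomorphic.isEvolutionAlgebra (h : Isomorphic K A B) (hA : IsEvolutionAlgebra K A) :
    IsEvolutionAlgebra K B := by
  obtain ⟨f, hf⟩ := h
  obtain ⟨S, hS⟩ := hA
  have hker : LinearMap.ker (f : A →ₗ[K] B) = ⊥ := LinearMap.ker_eq_bot.2 hf.1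
  refine ⟨f '' S, ?_, ?_, ?_⟩
  · have hli : LinearIndependent K ((↑) : S → A) := hS.linearIndepOn
    have := (hli.map' (f : A →ₗ[K] B) hker).linearIndepOn_id
    have himg : f '' S = Set.range ((f : A →ₗ[K] B) ∘ ((↑) : S → A)) := by
      rw [Set.range_comp, Subtype.range_coe]
      rfl
    rw [himg]
    exact this
  · have : (Submodule.span K S).map (f : A →ₗ[K] B) = Submodule.span K (f '' S) :=
      Submodule.map_span _ _
    rw [← this, hS.span_eq, Submodule.map_top]
    exact LinearMap.range_eq_top.2 hf.2
  · rintro _ ⟨x, hx, rfl⟩ _ ⟨y, hy, rfl⟩ hxy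
    rw [← map_mul, hS.mul_eq_zero x hx y hy fun h => hxy (congrArg f h), map_zero]

theorem Isomorphic.finrank_eq (h : Isomorphic K A B) : Module.finrank K A = Module.finrank K B := by
  obtain ⟨f, hf⟩ := h
  exact (LinearEquiv.ofBijective (f : A →ₗ[K] B) hf).finrank_eq

/-- The classification asks for a nilpotent factor in `Type`, whatever the universe of the given
algebra. -/
theorem isomorphic_shrink [Small.{0} A] : Isomorphic K (Shrink.{0} A) A := by
  refine ⟨{ Shrink.linearEquiv K A with
    map_zero' := map_zero (Shrink.linearEquiv K A)
    map_mul' := fun x y => equivShrink_symm_mul x y }, (Shrink.linearEquiv K A).bijective⟩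

instance [Small.{0} A] [SMulCommClass K A A] :
    SMulCommClass K (Shrink.{0} A) (Shrink.{0} A) :=
  ⟨fun c x y => (equivShrink A).symm.injective (by
    simp only [smul_eq_mul, equivShrink_symm_smul, equivShrink_symm_mul, mul_smul_comm])⟩

instance [Small.{0} A] [IsScalarTower K A A] :
    IsScalarTower K (Shrink.{0} A) (Shrink.{0} A) :=
  ⟨fun c x y => (equivShrink A).symm.injective (by
    simp only [smul_eq_mul, equivShrink_symm_smul, equivShrink_symm_mul, smul_mul_assoc])⟩

instance (k : ℕ) : FiniteDimensional K (ZeroAlgebra K k) :=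
  inferInstanceAs (FiniteDimensional K (Fin k → K))

theorem finrank_zeroAlgebra (k : ℕ) : Module.finrank K (ZeroAlgebra K k) = k :=
  Module.finrank_fin_fun (n := k) K

/-- An algebra that is the direct sum of the line spanned by an idempotent and a subalgebra
annihilated by it. -/
theorem isomorphic_prod_of_idempotent [SMulCommClass K A A] [IsScalarTower K A A]
    (hc : ∀ x y : A, x * y = y * x) {e : A} {N : NonUnitalSubalgebra K A} (he : e * e = e)
    (he0 : e ≠ 0) (heN : ∀ x ∈ N, e * x = 0)
    (hN : IsCompl (Submodule.span K {e}) N.toSubmodule) : Isomorphic K A (K × N) := by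
  let φ : (K × N) ≃ₗ[K] A :=
    ((LinearEquiv.toSpanNonzeroSingleton K A e he0).prodCongr (LinearEquiv.refl K N)).trans
      (Submodule.prodEquivOfIsCompl _ _ hN)
  have hφ : ∀ p, φ p = p.1 • e + (p.2 : A) := fun p => rfl
  refine Isomorphic.symm ⟨{ φ with
    map_zero' := map_zero φ
    map_mul' := fun p q => ?_ }, φ.bijective⟩
  change φ (p * q) = φ p * φ q
  rw [hφ, hφ, hφ, add_mul, mul_add, mul_add, smul_mul_smul_comm, he, smul_mul_assoc,
    heN _ q.2.2, mul_smul_comm, hc (p.2 : A) e, heN _ p.2.2, smul_zero, smul_zero, add_zero,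
    zero_add]
  rfl

/-- An algebra that is the direct sum of a subalgebra and a subspace of its annihilator. -/
theorem isomorphic_prod_zeroAlgebra [FiniteDimensional K A]
    (hc : ∀ x y : A, x * y = y * x) {F : NonUnitalSubalgebra K A} {Z : Submodule K A}
    (hZ : ∀ z ∈ Z, ∀ y, z * y = 0) (hF : IsCompl F.toSubmodule Z) {k : ℕ}
    (hk : Module.finrank K Z = k) : Isomorphic K A (F × ZeroAlgebra K k) := by
  let ψ : ZeroAlgebra K k ≃ₗ[K] Z :=
    (LinearEquiv.ofFinrankEq Z (ZeroAlgebra K k) (by rw [hk, finrank_zeroAlgebra])).symm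
  let φ : (F × ZeroAlgebra K k) ≃ₗ[K] A :=
    ((LinearEquiv.refl K F).prodCongr ψ).trans (Submodule.prodEquivOfIsCompl _ _ hF)
  have hφ : ∀ p, φ p = (p.1 : A) + (ψ p.2 : A) := fun p => rfl
  refine Isomorphic.symm ⟨{ φ with
    map_zero' := map_zero φ
    map_mul' := fun p q => ?_ }, φ.bijective⟩
  change φ (p * q) = φ p * φ q
  have h0 : ψ (p * q).2 = 0 := map_zero ψ
  rw [hφ, hφ, hφ, h0, add_mul, mul_add, hZ _ (ψ p.2).2, hc (p.1 : A) (ψ q.2), hZ _ (ψ q.2).2]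
  simp

theorem isomorphic_zeroAlgebra [FiniteDimensional K A] (h : ∀ x y : A, x * y = 0) {k : ℕ}
    (hk : Module.finrank K A = k) : Isomorphic K A (ZeroAlgebra K k) := by
  let ψ : A ≃ₗ[K] ZeroAlgebra K k :=
    LinearEquiv.ofFinrankEq A (ZeroAlgebra K k) (by rw [hk, finrank_zeroAlgebra])
  refine ⟨{ ψ with
    map_zero' := map_zero ψ
    map_mul' := fun x y => ?_ }, ψ.bijective⟩
  change ψ (x * y) = 0
  rw [h, map_zero]

end Isomorphisms

/-! ### A nilpotent evolution algebra of the largest index. -/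

section Shift

universe u v

/-- The algebra with basis `e_0, …, e_{s-1}` and nonzero products `e_i² = e_{i+1}`. -/
def ShiftAlgebra (K : Type u) (s : ℕ) : Type (max u v) := ULift.{v} (Fin s) → K

namespace ShiftAlgebra

variable (K : Type u) [Field K] (s : ℕ)

instance : AddCommGroup (ShiftAlgebra.{u, v} K s) :=
  inferInstanceAs (AddCommGroup (ULift.{v} (Fin s) → K))

instance : Module K (ShiftAlgebra.{u, v} K s) :=
  inferInstanceAs (Module K (ULift.{v} (Fin s) → K))

variable {s} in
/-- The preceding index. -/
def pred (i : ULift.{v} (Fin s)) : ULift.{v} (Fin s) := ⟨⟨i.down.1 - 1, by omega⟩⟩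

instance : Mul (ShiftAlgebra.{u, v} K s) :=
  ⟨fun x y i => if i.down.1 = 0 then 0 else x (pred i) * y (pred i)⟩

variable {K s}

theorem mul_apply (x y : ShiftAlgebra.{u, v} K s) (i : ULift.{v} (Fin s)) :
    (x * y) i = if i.down.1 = 0 then 0 else x (pred i) * y (pred i) := rfl

theorem add_apply (x y : ShiftAlgebra.{u, v} K s) (i : ULift.{v} (Fin s)) :
    (x + y) i = x i + y i := rfl

theorem smul_apply (c : K) (x : ShiftAlgebra.{u, v} K s) (i : ULift.{v} (Fin s)) :
    (c • x) i = c * x i := rfl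

theorem zero_apply (i : ULift.{v} (Fin s)) : (0 : ShiftAlgebra.{u, v} K s) i = 0 := rfl

instance : NonUnitalNonAssocRing (ShiftAlgebra.{u, v} K s) :=
  { (inferInstance : AddCommGroup (ShiftAlgebra.{u, v} K s)),
    (inferInstance : Mul (ShiftAlgebra.{u, v} K s)) with
    left_distrib := fun x y z => funext fun i => by
      simp only [mul_apply, add_apply]; split_ifs <;> ring
    right_distrib := fun x y z => funext fun i => by
      simp only [mul_apply, add_apply]; split_ifs <;> ring
    zero_mul := fun x => funext fun i => by simp [mul_apply, zero_apply]
    mul_zero := fun x => funext fun i => by simp [mul_apply, zero_apply] }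

instance : SMulCommClass K (ShiftAlgebra.{u, v} K s) (ShiftAlgebra.{u, v} K s) :=
  ⟨fun c x y => funext fun i => by
    simp only [smul_eq_mul, mul_apply, smul_apply]; split_ifs <;> ring⟩

instance : IsScalarTower K (ShiftAlgebra.{u, v} K s) (ShiftAlgebra.{u, v} K s) :=
  ⟨fun c x y => funext fun i => by
    simp only [smul_eq_mul, mul_apply, smul_apply]; split_ifs <;> ring⟩

instance : FiniteDimensional K (ShiftAlgebra.{u, v} K s) :=
  inferInstanceAs (FiniteDimensional K (ULift.{v} (Fin s) → K))

theorem finrank_eq : Module.finrank K (ShiftAlgebra.{u, v} K s) = s := by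
  have : Module.finrank K (ULift.{v} (Fin s) → K) = s := by
    rw [Module.finrank_fintype_fun_eq_card, Fintype.card_ulift, Fintype.card_fin]
  exact this

theorem isEvolutionAlgebra : IsEvolutionAlgebra K (ShiftAlgebra.{u, v} K s) := by
  classical
  let b : Module.Basis (ULift.{v} (Fin s)) K (ShiftAlgebra.{u, v} K s) :=
    Pi.basisFun K (ULift.{v} (Fin s))
  have hb : ∀ i, b i = (Pi.single i 1 : ULift.{v} (Fin s) → K) := fun i => Pi.basisFun_apply K _ i
  refine ⟨Set.range b, b.linearIndependent.linearIndepOn_id, b.span_eq, ?_⟩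
  rintro _ ⟨i, rfl⟩ _ ⟨j, rfl⟩ hij
  have hij' : i ≠ j := fun h => hij (congrArg b h)
  funext k
  rw [mul_apply, hb, hb, zero_apply]
  split_ifs
  · rfl
  · by_cases h : pred k = i
    · rw [h, Pi.single_eq_of_ne hij', mul_zero]
    · rw [Pi.single_eq_of_ne h, zero_mul]

theorem mem_annSeries (k : ℕ) (x : ShiftAlgebra.{u, v} K s)
    (hx : ∀ i : ULift.{v} (Fin s), i.down.1 + k < s → x i = 0) :
    x ∈ annSeries K (ShiftAlgebra.{u, v} K s) k := by
  induction k generalizing x with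
  | zero => exact funext fun i => hx i i.down.2
  | succ k ih =>
    refine fun y => ih _ fun i hi => ?_
    rw [mul_apply]
    split_ifs with h0
    · rfl
    · rw [hx (pred i) (by simp only [pred]; omega), zero_mul]

theorem isNilpotentAlgebra : IsNilpotentAlgebra K (ShiftAlgebra.{u, v} K s) :=
  isNilpotentAlgebra_of_annSeries_eq_top isEvolutionAlgebra.mul_comm (s := s)
    (Submodule.eq_top_iff'.2 fun x => mem_annSeries s x fun i hi => by omega)

theorem power_ne_bot (hs : 1 ≤ s) : power K (ShiftAlgebra.{u, v} K s) (2 ^ (s - 1)) ≠ ⊥ := by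
  intro h
  let x : ShiftAlgebra.{u, v} K s := fun i => if i.down.1 = 0 then 1 else 0
  -- The iterated squares of `e_0` are the successive basis vectors.
  have hx : ∀ k, k < s → ∀ i, iterSq x k i = if i.down.1 = k then 1 else 0 := by
    intro k hk
    induction k with
    | zero => exact fun i => rfl
    | succ k ih =>
      intro i
      change (iterSq x k * iterSq x k) i = _
      have hp := ih (by omega) (pred i)
      have hd : (pred i).down.1 = i.down.1 - 1 := rfl
      by_cases h0 : i.down.1 = 0
      · rw [mul_apply, if_pos h0]
        exact (if_neg (by omega)).symm
      · by_cases hi : i.down.1 = k + 1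
        · have h1 : iterSq x k (pred i) = 1 := hp.trans (if_pos (by omega))
          rw [mul_apply, if_neg h0, h1, one_mul]
          exact (if_pos hi).symm
        · have h1 : iterSq x k (pred i) = 0 := hp.trans (if_neg (by omega))
          rw [mul_apply, if_neg h0, h1, zero_mul]
          exact (if_neg hi).symm
  have hmem := iterSq_mem_power (K := K) x (s - 1)
  rw [h, Submodule.mem_bot] at hmem
  have := hx (s - 1) (by omega) ⟨⟨s - 1, by omega⟩⟩
  rw [hmem, zero_apply, if_pos rfl] at this
  exact zero_ne_one this

end ShiftAlgebra

end Shift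

/-! ### Maximal index of nilpotency and uniqueness. -/

section Maximal

theorem nilpotencyIndex_le_iff {K A : Type*} [Field K] [NonUnitalNonAssocRing A] [Module K A]
    (hn : IsNilpotentAlgebra K A) {k : ℕ} (hk : 1 ≤ k) :
    nilpotencyIndex K A ≤ k ↔ power K A k = ⊥ := by
  constructor
  · intro h
    obtain ⟨h1, h2⟩ := Nat.sInf_mem (s := {k : ℕ | 1 ≤ k ∧ power K A k = ⊥}) hn
    change 1 ≤ nilpotencyIndex K A at h1
    change power K A (nilpotencyIndex K A) = ⊥ at h2
    obtain ⟨i, hi⟩ : ∃ i, nilpotencyIndex K A = i + 1 := ⟨nilpotencyIndex K A - 1, by omega⟩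
    obtain ⟨j, rfl⟩ : ∃ j, k = j + 1 := ⟨k - 1, by omega⟩
    rw [hi] at h2 h
    exact le_bot_iff.1 (h2 ▸ power_antitone (by omega))
  · exact fun h => Nat.sInf_le ⟨hk, h⟩

universe v

/-- Comparison with the shift algebra. With `K : Type` it can be placed in the universe of `A`, the
one over which `maximal` quantifies. -/
theorem HasMaximalNilpotencyIndex.power_ne_bot {K : Type} {A : Type v} [Field K]
    [NonUnitalNonAssocRing A] [Module K A] {s : ℕ} (h : HasMaximalNilpotencyIndex K A s)
    (hs : 1 ≤ s) : power K A (2 ^ (s - 1)) ≠ ⊥ := by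
  intro hbot
  have h1 := h.maximal (ShiftAlgebra.{0, v} K s) ShiftAlgebra.finrank_eq
    ShiftAlgebra.isEvolutionAlgebra ShiftAlgebra.isNilpotentAlgebra
  have h2 := (nilpotencyIndex_le_iff h.isNilpotentAlgebra Nat.one_le_two_pow).2 hbot
  exact ShiftAlgebra.power_ne_bot.{0, v} (K := K) hs
    ((nilpotencyIndex_le_iff ShiftAlgebra.isNilpotentAlgebra Nat.one_le_two_pow).1 (h1.trans h2))

theorem hasMaximalNilpotencyIndex_of_power_ne_bot {K A : Type*} [Field K]
    [NonUnitalNonAssocRing A] [Module K A] [FiniteDimensional K A] {s : ℕ} (hs : 1 ≤ s)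
    (hA : Module.finrank K A = s) (he : IsEvolutionAlgebra K A) (hn : IsNilpotentAlgebra K A)
    (hp : power K A (2 ^ (s - 1)) ≠ ⊥) : HasMaximalNilpotencyIndex K A s := by
  refine ⟨inferInstance, hA, he, hn, ?_⟩
  intro B _ _ _ _ _ hB heB hnB
  have h1 : nilpotencyIndex K B ≤ 2 ^ (s - 1) + 1 := by
    rw [nilpotencyIndex_le_iff hnB (Nat.le_add_left _ _)]
    refine power_eq_bot_of_annSeries_eq_top heB.mul_comm ?_
    rw [Nat.sub_add_cancel hs, ← hB]
    exact annSeries_finrank_eq_top hnB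
  have h2 : ¬ nilpotencyIndex K A ≤ 2 ^ (s - 1) := fun h =>
    hp ((nilpotencyIndex_le_iff hn Nat.one_le_two_pow).1 h)
  omega

variable {K : Type} {A : Type v} [Field K] [NonUnitalNonAssocRing A] [Module K A]
  [SMulCommClass K A A] [IsScalarTower K A A]

/-- In an algebra of maximal index of nilpotency the annihilator is a line contained in the
square. -/
theorem HasMaximalNilpotencyIndex.exists_annihilator_generator {s : ℕ}
    (h : HasMaximalNilpotencyIndex K A s) (hs : 2 ≤ s) :
    ∃ z ∈ power K A 2, z ≠ 0 ∧ ∀ x ∈ annSeries K A 1, ∃ c : K, c • z = x := by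
  have := h.finiteDimensional
  have hc := h.isEvolutionAlgebra.mul_comm
  have hp := h.power_ne_bot (by omega)
  obtain ⟨r, rfl⟩ : ∃ r, s = r + 2 := ⟨s - 2, by omega⟩
  have hpow : 2 ^ (r + 2 - 1) = 2 ^ r + (2 ^ r - 1) + 1 := by
    have := Nat.one_le_two_pow (n := r)
    have h2 : 2 ^ (r + 2 - 1) = 2 ^ r * 2 := pow_succ 2 r
    omega
  rw [hpow] at hp
  -- An annihilator of dimension at least two would make the series reach the top one step early,
  -- which halves the exponent in the bound on the index.
  have hfin : Module.finrank K (annSeries K A 1) ≤ 1 := by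
    by_contra hlt
    have htop : annSeries K A (r + 1) = ⊤ := by
      rw [add_comm]
      exact annSeries_add_eq_top h.isNilpotentAlgebra (by rw [h.finrank_eq]; omega)
    have hb := power_eq_bot_of_annSeries_eq_top hc htop
    exact hp (le_bot_iff.1 (hb ▸ power_antitone (Nat.le_add_right _ _)))
  have hle : power K A (2 ^ r + (2 ^ r - 1) + 1) ≤ annSeries K A 1 := by
    refine (power_antitone (Nat.le_add_right _ _)).trans (power_le_annSeries hc r 1 ?_)
    have : 1 + r + 1 = r + 2 := by omega
    rw [this, ← h.finrank_eq]
    exact annSeries_finrank_eq_top h.isNilpotentAlgebra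
  obtain ⟨z, hz, hz0⟩ := (Submodule.ne_bot_iff _).1 hp
  refine ⟨z, power_antitone (i := 1) ?_ hz, hz0, fun x hx => ?_⟩
  · have := Nat.one_le_two_pow (n := r)
    omega
  · obtain ⟨w, hw⟩ := finrank_le_one_iff.1 hfin
    obtain ⟨a, ha⟩ := hw ⟨z, hle hz⟩
    obtain ⟨b, hb⟩ := hw ⟨x, hx⟩
    have ha' : a • (w : A) = z := congrArg Subtype.val ha
    have hb' : b • (w : A) = x := congrArg Subtype.val hb
    have ha0 : a ≠ 0 := by
      rintro rfl
      rw [zero_smul] at ha'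
      exact hz0 ha'.symm
    exact ⟨b * a⁻¹, by rw [← ha', ← hb', smul_smul, mul_assoc, inv_mul_cancel₀ ha0, mul_one]⟩

/-- A kernel element in a given level has all its products in the kernel one level lower, where the
kernel is zero by induction. So it annihilates the algebra and is a multiple of `z`. -/
theorem injective_of_annihilator {B : Type*} [NonUnitalNonAssocRing B] [Module K B]
    (hn : IsNilpotentAlgebra K A) [FiniteDimensional K A]
    (g : A →ₙₐ[K] B) {z : A}
    (hz : ∀ x ∈ annSeries K A 1, ∃ c : K, c • z = x) (hgz : g z ≠ 0) : Function.Injective g := by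
  have key : ∀ k, ∀ x ∈ annSeries K A k, g x = 0 → x = 0 := by
    intro k
    induction k with
    | zero => exact fun x hx _ => hx
    | succ k ih =>
      intro x hx hgx
      obtain ⟨c, rfl⟩ := hz x (mem_annSeries_one.2 fun y => ih _ (hx y) (by
        rw [map_mul, hgx, zero_mul]))
      rw [map_smul] at hgx
      rw [(smul_eq_zero.1 hgx).resolve_right hgz, zero_smul]
  intro x y hxy
  refine sub_eq_zero.1 (key (Module.finrank K A) _ ?_ (by rw [map_sub, hxy, sub_self]))
  rw [annSeries_finrank_eq_top hn]
  trivial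

/-- Iterated squares vanish eventually in a nilpotent algebra, but never for a nonzero element of a
field. -/
theorem IsNilpotentAlgebra.map_to_field_eq_zero {K A : Type*} [Field K] [NonUnitalNonAssocRing A]
    [Module K A] (hn : IsNilpotentAlgebra K A) (g : A →ₙₐ[K] K) (x : A) : g x = 0 := by
  by_contra hx
  have h : ∀ k, g (iterSq x k) ≠ 0 := by
    intro k
    induction k with
    | zero => exact hx
    | succ k ih => rw [iterSq, map_mul]; exact mul_ne_zero ih ih
  obtain ⟨n, hn1, hn⟩ := hn
  obtain ⟨m, rfl⟩ : ∃ m, n = m + 1 := ⟨n - 1, by omega⟩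
  obtain ⟨k, hk⟩ : ∃ k, 2 ^ (m + 1) = k + 1 :=
    ⟨2 ^ (m + 1) - 1, by have := Nat.one_le_two_pow (n := m + 1); omega⟩
  have hlt : m + 1 < 2 ^ (m + 1) := Nat.lt_two_pow_self
  have hmem := iterSq_mem_power (K := K) x (m + 1)
  rw [hk] at hmem
  have h0 := power_antitone (by omega : m ≤ k) hmem
  rw [hn, Submodule.mem_bot] at h0
  exact h (m + 1) (by rw [h0, map_zero])

theorem map_zeroAlgebra_eq_zero {K A : Type*} [Field K] [NonUnitalNonAssocRing A]
    [Module K A] {k : ℕ} (g : A →ₙₐ[K] ZeroAlgebra K k) {x : A} (hx : x ∈ power K A 2) :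
    g x = 0 := by
  have hbot : power K (ZeroAlgebra K k) 2 ≤ ⊥ := power_add_two_le fun _ _ _ x _ y _ => rfl
  exact hbot (map_mem_power g 1 hx)

variable {B : Type*} [NonUnitalNonAssocRing B] [Module K B]

/-- On the generator `z` of the annihilator, the `K` component vanishes by nilpotency and the
zero-algebra component because `z` lies in the square. Only the `B` component can detect `z`. -/
theorem HasMaximalNilpotencyIndex.exists_injective {s : ℕ} (h : HasMaximalNilpotencyIndex K A s)
    (hs : 2 ≤ s) {i j : ℕ} (f : (K × A × ZeroAlgebra K i) →ₙₐ[K] (K × B × ZeroAlgebra K j))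
    (hf : Function.Injective f) : ∃ g : A →ₙₐ[K] B, Function.Injective g := by
  have := h.finiteDimensional
  let ι : A →ₙₐ[K] (K × A × ZeroAlgebra K i) :=
    (NonUnitalAlgHom.inr K K (A × ZeroAlgebra K i)).comp (NonUnitalAlgHom.inl K A (ZeroAlgebra K i))
  have hι : ∀ x, ι x = (0, x, 0) := fun x => rfl
  let F := f.comp ι
  obtain ⟨z, hz2, hz0, hz⟩ := h.exists_annihilator_generator hs
  let g₁ := (NonUnitalAlgHom.fst K K (B × ZeroAlgebra K j)).comp F
  let g₂ := (NonUnitalAlgHom.snd K K (B × ZeroAlgebra K j)).comp F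
  let g₃ := (NonUnitalAlgHom.fst K B (ZeroAlgebra K j)).comp g₂
  let g₄ := (NonUnitalAlgHom.snd K B (ZeroAlgebra K j)).comp g₂
  refine ⟨g₃, injective_of_annihilator h.isNilpotentAlgebra g₃ hz ?_⟩
  intro h3
  have h1 : g₁ z = 0 := h.isNilpotentAlgebra.map_to_field_eq_zero g₁ z
  have h4 : g₄ z = 0 := map_zeroAlgebra_eq_zero g₄ hz2
  have hFz : f (ι z) = 0 := Prod.ext h1 (Prod.ext h3 h4)
  have : ι z = 0 := hf (by rw [hFz, map_zero])
  exact hz0 (congrArg (fun p => p.2.1) this)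

theorem HasMaximalNilpotencyIndex.not_injective {s : ℕ} (h : HasMaximalNilpotencyIndex K A s)
    (hs : 2 ≤ s) {i j : ℕ} (f : (K × A × ZeroAlgebra K i) →ₙₐ[K] (K × ZeroAlgebra K j)) :
    ¬ Function.Injective f := by
  intro hf
  let ι : A →ₙₐ[K] (K × A × ZeroAlgebra K i) :=
    (NonUnitalAlgHom.inr K K (A × ZeroAlgebra K i)).comp (NonUnitalAlgHom.inl K A (ZeroAlgebra K i))
  let F := f.comp ι
  obtain ⟨z, hz2, hz0, hz⟩ := h.exists_annihilator_generator hs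
  have h1 := h.isNilpotentAlgebra.map_to_field_eq_zero
    ((NonUnitalAlgHom.fst K K (ZeroAlgebra K j)).comp F) z
  have h2 := map_zeroAlgebra_eq_zero ((NonUnitalAlgHom.snd K K (ZeroAlgebra K j)).comp F) hz2
  have hFz : f (ι z) = 0 := Prod.ext h1 h2
  have : ι z = 0 := hf (by rw [hFz, map_zero])
  exact hz0 (congrArg (fun p => p.2.1) this)

end Maximal

end EvolutionAlgebra

/- The algebra with basis `e₁` and `e₁² = e₁` is `ℂ` with its usual multiplication (`e₁ = 1`), and
direct sums of algebras are products with componentwise operations. -/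
open EvolutionAlgebra in
theorem mainTheorem3 (n : ℕ) :
    -- every non-nilpotent complete evolution algebra of dimension `n` is in the list
    (∀ (E : Type*) [NonUnitalNonAssocRing E] [Module ℂ E] [SMulCommClass ℂ E E]
        [IsScalarTower ℂ E E] [FiniteDimensional ℂ E],
      Module.finrank ℂ E = n → IsCompleteEvolutionAlgebra ℂ E → ¬ IsNilpotentAlgebra ℂ E →
        Isomorphic ℂ E (ℂ × ZeroAlgebra ℂ (n - 1)) ∨
        ∃ s : ℕ, 2 ≤ s ∧ s + 1 ≤ n ∧
          ∃ (F : Type) (_ : NonUnitalNonAssocRing F) (_ : Module ℂ F) (_ : SMulCommClass ℂ F F)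
            (_ : IsScalarTower ℂ F F), HasMaximalNilpotencyIndex ℂ F s ∧
            Isomorphic ℂ E (ℂ × F × ZeroAlgebra ℂ (n - s - 1))) ∧
    -- the first algebra is not isomorphic to any algebra of the second kind
    (∀ (s : ℕ), 2 ≤ s → s + 1 ≤ n →
      ∀ (F : Type*) [NonUnitalNonAssocRing F] [Module ℂ F] [SMulCommClass ℂ F F]
        [IsScalarTower ℂ F F], HasMaximalNilpotencyIndex ℂ F s →
        ¬ Isomorphic ℂ (ℂ × ZeroAlgebra ℂ (n - 1)) (ℂ × F × ZeroAlgebra ℂ (n - s - 1))) ∧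
    -- different data `s`, `F` (up to isomorphism) give non-isomorphic algebras of the second kind
    (∀ (s t : ℕ), 2 ≤ s → s + 1 ≤ n → 2 ≤ t → t + 1 ≤ n →
      ∀ (F : Type*) [NonUnitalNonAssocRing F] [Module ℂ F] [SMulCommClass ℂ F F]
        [IsScalarTower ℂ F F] (G : Type*) [NonUnitalNonAssocRing G] [Module ℂ G]
        [SMulCommClass ℂ G G] [IsScalarTower ℂ G G],
        HasMaximalNilpotencyIndex ℂ F s → HasMaximalNilpotencyIndex ℂ G t →
        Isomorphic ℂ (ℂ × F × ZeroAlgebra ℂ (n - s - 1)) (ℂ × G × ZeroAlgebra ℂ (n - t - 1)) →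
        s = t ∧ Isomorphic ℂ F G) := by
  refine ⟨?_, ?_, ?_⟩
  · intro E _ _ _ _ _ hE hcomplete hnil
    have hc := hcomplete.1.mul_comm
    obtain ⟨e, N, he, he0, heN, hcompl, hN⟩ := hcomplete.exists_idempotent_decomposition hnil
    have hEN : Isomorphic ℂ E (ℂ × N) := isomorphic_prod_of_idempotent hc he he0 heN hcompl
    have : FiniteDimensional ℂ N := FiniteDimensional.finiteDimensional_submodule N.toSubmodule
    have hNrank : 1 + Module.finrank ℂ N = n := by
      have h := Submodule.finrank_add_eq_of_isCompl hcompl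
      rw [finrank_span_singleton he0, hE] at h
      exact h
    by_cases hzero : ∀ x y : N, x * y = 0
    · refine Or.inl (hEN.trans ((Isomorphic.refl ℂ ℂ).prod (isomorphic_zeroAlgebra hzero ?_)))
      omega
    · push Not at hzero
      obtain ⟨F, Z, hFZ, hZ, hF2, hFn, hFp⟩ :=
        (hcomplete.hasAdaptedBases.subalgebra N).exists_nilpotent_decomposition hN hzero
      have hcN : ∀ x y : N, x * y = y * x := fun x y => Subtype.ext (hc x y)
      have : FiniteDimensional ℂ F := FiniteDimensional.finiteDimensional_submodule F.toSubmodule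
      have hFrank : Module.finrank ℂ F + Module.finrank ℂ Z = Module.finrank ℂ N :=
        Submodule.finrank_add_eq_of_isCompl hFZ
      have hsmall : Small.{0} F :=
        small_of_injective (LinearEquiv.ofFinrankEq F (Fin (Module.finrank ℂ F) → ℂ)
          (Module.finrank_fin_fun ℂ).symm).injective
      have hiso : Isomorphic ℂ F (Shrink.{0} F) := isomorphic_shrink.symm
      have hFev : IsEvolutionAlgebra ℂ F :=
        ((hcomplete.hasAdaptedBases.subalgebra N).subalgebra F).isEvolutionAlgebra
      have : FiniteDimensional ℂ (Shrink.{0} F) :=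
        (Shrink.linearEquiv ℂ F).symm.finiteDimensional
      refine Or.inr ⟨Module.finrank ℂ F, hF2, by omega, Shrink.{0} F, inferInstance, inferInstance,
        inferInstance, inferInstance, ?_, ?_⟩
      · exact hasMaximalNilpotencyIndex_of_power_ne_bot (by omega) hiso.finrank_eq.symm
          (hiso.isEvolutionAlgebra hFev) (hiso.isNilpotentAlgebra hFn)
          fun h => hFp (hiso.symm.power_eq_bot Nat.one_le_two_pow h)
      · refine hEN.trans ((Isomorphic.refl ℂ ℂ).prod ((isomorphic_prod_zeroAlgebra hcN hZ hFZ
          (k := n - Module.finrank ℂ F - 1) (by omega)).trans (hiso.prod (Isomorphic.refl ℂ _))))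
  · intro s hs hsn F _ _ _ _ hF hiso
    obtain ⟨f, hf⟩ := hiso.symm
    exact hF.not_injective hs f hf.1
  · intro s t hs hsn ht htn F _ _ _ _ G _ _ _ _ hF hG hiso
    obtain ⟨f, hf⟩ := hiso
    obtain ⟨f', hf'⟩ := Isomorphic.symm ⟨f, hf⟩
    obtain ⟨g, hg⟩ := hF.exists_injective hs f hf.1
    obtain ⟨g', hg'⟩ := hG.exists_injective ht f' hf'.1
    have := hF.finiteDimensional
    have := hG.finiteDimensional
    have h1 := LinearMap.finrank_le_finrank_of_injective (f := (g : F →ₗ[ℂ] G)) hg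
    have h2 := LinearMap.finrank_le_finrank_of_injective (f := (g' : G →ₗ[ℂ] F)) hg'
    -- Embeddings in both directions force equal dimensions, so `g` is bijective.
    have hrank := le_antisymm h1 h2
    refine ⟨by rw [← hF.finrank_eq, ← hG.finrank_eq, hrank], g, hg, ?_⟩
    exact (LinearMap.injective_iff_surjective_of_finrank_eq_finrank
      (f := (g : F →ₗ[ℂ] G)) hrank).1 hg
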